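/- Let $M=M^5\subset\mathbb{C}^3$ be a real-analytic (embedded) real hypersurface. Let $T^{1,0}M=\{X-iJX : X\in TM\cap J(TM)\}$ and $T^{0,1}M=\overline{T^{1,0}M}$, and assume that the Levi form of $M$, i.e. the Hermitian form $(\mathcal L,\mathcal L')\mapsto i[\mathcal L,\overline{\mathcal L'}](p)$ modulo $T^{1,0}_pM\oplus T^{0,1}_pM$ on $T^{1,0}_pM$ (with $\mathcal L,\mathcal L'$ local sections of $T^{1,0}M$), has rank exactly $1$ at every point $p\in M$. Let $K^{1,0}M\subset T^{1,0}M$ be the complex line bundle of kernels of the Levi form, and let the Freeman form of $M$ at $p$ be the map $$K^{1,0}_pM\times\big(T^{1,0}_pM \bmod K^{1,0}_pM\big)\ni(\mathcal K_p,\mathcal L_p)\longmapsto[\mathcal K,\overline{\mathcal L}](p)\ \bmod\ \big(K^{1,0}_pM\oplus T^{0,1}_pM\big),$$ where $\mathcal K$, $\mathcal L$ are any local real-analytic sections of $K^{1,0}M$, $T^{1,0}M$ extending $\mathcal K_p$, $\mathcal L_p$ (the result does not depend on the extensions). Then the Freeman form vanishes at every point of $M$ if and only if $M$ is locally biholomorphic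 to a product $M^3\times\mathbb{C}$, that is: for every $p\in M$ there are a real-analytic real hypersurface $M^3\subset\mathbb{C}^2$ and a biholomorphism $h:U\to V$ from an open neighborhood $U$ of $p$ in $\mathbb{C}^3$ onto an open set $V\subset\mathbb{C}^2\times\mathbb{C}$ with $h(M\cap U)=(M^3\times\mathbb{C})\cap V$. -/

import Mathlib

open Set Filter Topology

noncomputable section

namespace CRGeom

/-- A real-analytic (embedded) real hypersurface of a real normed space: near each of its points
it is the zero set of a real-analytic function with nonvanishing differential. -/
def IsRealAnalyticHypersurface {E : Type*} [NormedAddCommGroup E] [NormedSpace ℝ E]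
    (M : Set E) : Prop :=
  ∀ p ∈ M, ∃ r : E → ℝ, AnalyticAt ℝ r p ∧ fderiv ℝ r p ≠ 0 ∧ ∀ᶠ q in 𝓝 p, (q ∈ M ↔ r q = 0)

/-- The space `ℂ³`. -/
abbrev C3 : Type := Fin 3 → ℂ

/-- The complexified tangent space `ℂ ⊗ T ℂ³` at a point: the pair `(a, b)` stands for
`∑ aⱼ ∂/∂zⱼ + ∑ bⱼ ∂/∂z̄ⱼ`. -/
abbrev CVec : Type := C3 × C3

/-- The real tangent vector `x ∈ ℂ³ = ℝ⁶`, seen as the complex vector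
`∑ xⱼ ∂/∂zⱼ + ∑ x̄ⱼ ∂/∂z̄ⱼ`. -/
def realVec (x : C3) : CVec := (x, star x)

/-- Complex conjugation on `ℂ ⊗ T ℂ³`; it fixes the vectors `realVec x`. -/
def conjVec : CVec →ₛₗ[starRingEnd ℂ] CVec where
  toFun Z := (star Z.2, star Z.1)
  map_add' Z W := by simp
  map_smul' c Z := by simp

/-- The `ℂ`-linear extension to `ℂ ⊗ T ℂ³` of an `ℝ`-linear map `φ` on `ℂ³ = ℝ⁶` with values in a
complex vector space, so that `complexify φ (realVec x) = φ x`. -/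
def complexify {F : Type*} [NormedAddCommGroup F] [NormedSpace ℂ F] (φ : C3 →L[ℝ] F) (Z : CVec) :
    F :=
  (1 / 2 : ℂ) • (φ Z.1 - Complex.I • φ (Complex.I • Z.1)) +
    (1 / 2 : ℂ) • (φ (star Z.2) + Complex.I • φ (Complex.I • star Z.2))

/-- The Lie bracket at `p` of two complex vector fields on (an open subset of) `ℂ³`. -/
def bracket (Z W : C3 → CVec) (p : C3) : CVec :=
  complexify (fderiv ℝ W p) (Z p) - complexify (fderiv ℝ Z p) (W p)

/-- The conjugate of a complex vector field. -/
def conjField (Z : C3 → CVec) : C3 → CVec := fun q => conjVec (Z q)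

/-- The real tangent space `T_p M ⊆ ℂ³ = ℝ⁶`: the common kernel of the differentials at `p` of the
real-analytic functions defined near `p` that vanish on `M`. -/
def tangentSpace (M : Set C3) (p : C3) : Submodule ℝ C3 where
  carrier := {x | ∀ r : C3 → ℝ, AnalyticAt ℝ r p → (∀ᶠ q in 𝓝[M] p, r q = 0) → fderiv ℝ r p x = 0}
  add_mem' hx hy r hr h0 := by rw [map_add, hx r hr h0, hy r hr h0, add_zero]
  zero_mem' r _ _ := map_zero _
  smul_mem' c x hx r hr h0 := by rw [map_smul, hx r hr h0, smul_zero]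

/-- The complexified tangent space `ℂ ⊗ T_p M`. -/
def complexTangentSpace (M : Set C3) (p : C3) : Submodule ℂ CVec :=
  Submodule.span ℂ (realVec '' (tangentSpace M p : Set C3))

/-- `T_p M ∩ J (T_p M)`, where `J` is multiplication by `i`. -/
def maximalComplexSubspace (M : Set C3) (p : C3) : Submodule ℂ C3 where
  carrier := {x | x ∈ tangentSpace M p ∧ Complex.I • x ∈ tangentSpace M p}
  add_mem' hx hy := by
    refine ⟨add_mem hx.1 hy.1, ?_⟩
    rw [smul_add]
    exact add_mem hx.2 hy.2
  zero_mem' := by simp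
  smul_mem' c x hx := by
    have key : ∀ c : ℂ, c • x ∈ tangentSpace M p := fun c => by
      have e : c • x = c.re • x + c.im • (Complex.I • x) := by
        ext j
        simp only [Pi.smul_apply, Pi.add_apply, smul_eq_mul, Complex.real_smul]
        conv_lhs => rw [← Complex.re_add_im c]
        ring
      rw [e]
      exact add_mem (Submodule.smul_mem _ _ hx.1) (Submodule.smul_mem _ _ hx.2)
    refine ⟨key c, ?_⟩
    rw [smul_smul]
    exact key _

/-- `T^{1,0}_p M = {X - i J X : X ∈ T_p M ∩ J (T_p M)}`. In the coordinates of `CVec` one has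
`realVec x - i • realVec (i • x) = (2 x, 0)`, so this is the space of the `(x, 0)` with
`x ∈ T_p M ∩ J (T_p M)`. -/
def T10 (M : Set C3) (p : C3) : Submodule ℂ CVec :=
  (maximalComplexSubspace M p).map (LinearMap.inl ℂ C3 C3)

/-- `T^{0,1}_p M`, the conjugate of `T^{1,0}_p M`. -/
def T01 (M : Set C3) (p : C3) : Submodule ℂ CVec :=
  (T10 M p).comap conjVec

/-- `Z` is, near `p`, a real-analytic section over `M` of the family of subspaces `B q`, `q ∈ M`
(given as the restriction to `M` of a real-analytic field on a neighborhood of `p` in `ℂ³`). -/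
def IsLocalSection (M : Set C3) (B : C3 → Submodule ℂ CVec) (p : C3) (Z : C3 → CVec) : Prop :=
  AnalyticAt ℝ Z p ∧ ∀ᶠ q in 𝓝[M] p, Z q ∈ B q

/-- `{L 0, L 1}` is a real-analytic local frame of `T^{1,0} M` near `p`. -/
def IsLocalT10Frame (M : Set C3) (p : C3) (L : Fin 2 → C3 → CVec) : Prop :=
  (∀ i, IsLocalSection M (T10 M) p (L i)) ∧
    ∀ᶠ q in 𝓝[M] p, LinearIndependent ℂ (fun i => L i q) ∧
      Submodule.span ℂ (range fun i => L i q) = T10 M q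

/-- The value on a complex vector of the `ℂ`-linear extension of a real covector. -/
def evalForm (ρ : C3 →L[ℝ] ℝ) (Z : CVec) : ℂ :=
  complexify (Complex.ofRealCLM.comp ρ) Z

/-- `ρ` is, near `p`, a real-analytic real `1`-form whose complex extension satisfies
`{ρ = 0} = T^{1,0} M ⊕ T^{0,1} M` inside `ℂ ⊗ T M`. -/
def IsCharacteristicForm (M : Set C3) (p : C3) (ρ : C3 → C3 →L[ℝ] ℝ) : Prop :=
  AnalyticAt ℝ ρ p ∧ ∀ᶠ q in 𝓝[M] p, ∀ Z ∈ complexTangentSpace M q,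
    evalForm (ρ q) Z = 0 ↔ Z ∈ T10 M q ⊔ T01 M q

/-- The matrix of the Levi form at `p` in the frame `L`, with `(j, k)` entry
`ρ (i [L k, conj (L j)])`. -/
def leviMatrix (ρ : C3 → C3 →L[ℝ] ℝ) (L : Fin 2 → C3 → CVec) (p : C3) :
    Matrix (Fin 2) (Fin 2) ℂ :=
  Matrix.of fun j k => evalForm (ρ p) (Complex.I • bracket (L k) (conjField (L j)) p)

/-- The Levi form of `M` at `p` has rank `k`. The rank of the Levi matrix does not depend on the
frame of `T^{1,0} M` nor on the form `ρ`. -/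
def HasLeviRank (M : Set C3) (p : C3) (k : ℕ) : Prop :=
  ∃ (ρ : C3 → C3 →L[ℝ] ℝ) (L : Fin 2 → C3 → CVec),
    IsCharacteristicForm M p ρ ∧ IsLocalT10Frame M p L ∧ (leviMatrix ρ L p).rank = k

lemma complexify_add {F : Type*} [NormedAddCommGroup F] [NormedSpace ℂ F] (φ : C3 →L[ℝ] F)
    (Z W : CVec) : complexify φ (Z + W) = complexify φ Z + complexify φ W := by
  simp only [complexify, Prod.fst_add, Prod.snd_add, star_add, smul_add, map_add]
  module

lemma complexify_smul {F : Type*} [NormedAddCommGroup F] [NormedSpace ℂ F] (φ : C3 →L[ℝ] F)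
    (c : ℂ) (Z : CVec) : complexify φ (c • Z) = c • complexify φ Z := by
  have key : ∀ (c : ℂ) (x : C3), φ (c • x) = (c.re : ℂ) • φ x + (c.im : ℂ) • φ (Complex.I • x) := by
    intro c x
    have e : c • x = c.re • x + c.im • (Complex.I • x) := by
      ext j
      simp only [Pi.smul_apply, Pi.add_apply, smul_eq_mul, Complex.real_smul]
      conv_lhs => rw [← Complex.re_add_im c]
      ring
    rw [e, map_add, map_smul, map_smul, Complex.coe_smul, Complex.coe_smul]
  simp only [complexify, Prod.smul_fst, Prod.smul_snd, star_smul, smul_smul Complex.I]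
  rw [key c, key (Complex.I * c), key (star c), key (Complex.I * star c)]
  have hc := Complex.re_add_im c
  simp only [Complex.mul_re, Complex.mul_im, Complex.I_re, Complex.I_im, RCLike.star_def,
    Complex.conj_re, Complex.conj_im]
  conv_rhs => rw [← hc]
  push_cast
  have hI : Complex.I * Complex.I = -1 := Complex.I_mul_I
  match_scalars
  · ring
  · linear_combination (c.im / 2 : ℂ) * hI
  · ring
  · linear_combination (-c.im / 2 : ℂ) * hI

lemma bracket_add_left {Z Z' W : C3 → CVec} {p : C3} (hZ : AnalyticAt ℝ Z p)
    (hZ' : AnalyticAt ℝ Z' p) : bracket (Z + Z') W p = bracket Z W p + bracket Z' W p := by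
  have e : fderiv ℝ (Z + Z') p = fderiv ℝ Z p + fderiv ℝ Z' p :=
    fderiv_add hZ.differentiableAt hZ'.differentiableAt
  simp only [bracket, e, Pi.add_apply, complexify_add]
  simp only [complexify, add_apply, smul_add]
  module

lemma bracket_smul_left {Z W : C3 → CVec} {p : C3} (hZ : AnalyticAt ℝ Z p) (c : ℂ) :
    bracket (c • Z) W p = c • bracket Z W p := by
  have e : fderiv ℝ (c • Z) p = c • fderiv ℝ Z p := fderiv_const_smul hZ.differentiableAt c
  simp only [bracket, e, Pi.smul_apply, complexify_smul]
  simp only [complexify, smul_apply]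
  module

/-- `K^{1,0}_p M`, the kernel of the Levi form at `p`: the vectors of `T^{1,0}_p M` that extend to
a local section `L` of `T^{1,0} M` with `[L, conj L'](p) = 0` modulo `T^{1,0} M ⊕ T^{0,1} M` for
every local section `L'` of `T^{1,0} M`. (The class of this bracket depends only on `L p`, `L' p`.)
-/
def K10 (M : Set C3) (p : C3) : Submodule ℂ CVec where
  carrier := {ℓ | ℓ ∈ T10 M p ∧ ∃ L : C3 → CVec, IsLocalSection M (T10 M) p L ∧ L p = ℓ ∧
    ∀ L' : C3 → CVec, IsLocalSection M (T10 M) p L' →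
      bracket L (conjField L') p ∈ T10 M p ⊔ T01 M p}
  add_mem' := by
    rintro _ _ ⟨hx, X, hX, rfl, hX'⟩ ⟨hy, Y, hY, rfl, hY'⟩
    refine ⟨add_mem hx hy, X + Y, ⟨hX.1.add hY.1, ?_⟩, rfl, fun L' hL' => ?_⟩
    · filter_upwards [hX.2, hY.2] with q h1 h2 using add_mem h1 h2
    · rw [bracket_add_left hX.1 hY.1]
      exact add_mem (hX' L' hL') (hY' L' hL')
  zero_mem' := by
    refine ⟨zero_mem _, 0, ⟨analyticAt_const, .of_forall fun q => zero_mem _⟩, rfl, fun L' _ => ?_⟩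
    have h := bracket_smul_left (W := conjField L') (p := p)
      (Z := 0) (analyticAt_const (v := (0 : CVec))) 0
    rw [zero_smul, zero_smul] at h
    rw [h]
    exact zero_mem _
  smul_mem' := by
    rintro c _ ⟨hx, X, hX, rfl, hX'⟩
    refine ⟨Submodule.smul_mem _ c hx, c • X, ⟨analyticAt_const.smul hX.1, ?_⟩, rfl,
      fun L' hL' => ?_⟩
    · filter_upwards [hX.2] with q h1 using Submodule.smul_mem _ c h1
    · rw [bracket_smul_left hX.1]
      exact Submodule.smul_mem _ c (hX' L' hL')

/-- The value of the Freeman form at `p` on local sections `K` of `K^{1,0} M` and `L` of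
`T^{1,0} M`: the class of `[K, conj L](p)` modulo `K^{1,0}_p M ⊕ T^{0,1}_p M`. -/
def freemanForm (M : Set C3) (p : C3) (K L : C3 → CVec) : CVec ⧸ (K10 M p ⊔ T01 M p) :=
  Submodule.Quotient.mk (bracket K (conjField L) p)

/-- The Freeman form of `M` vanishes at `p`. -/
def FreemanFormVanishesAt (M : Set C3) (p : C3) : Prop :=
  ∀ K L : C3 → CVec, IsLocalSection M (K10 M) p K → IsLocalSection M (T10 M) p L →
    freemanForm M p K L = 0

/-- Near each of its points, `M` is mapped by a local biholomorphism of `ℂ³` onto an open piece of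
a product `M' × ℂ ⊆ ℂ² × ℂ`, where `M' ⊆ ℂ²` is a real-analytic hypersurface. -/
def IsLocallyBiholomorphicToProduct (M : Set C3) : Prop :=
  ∀ p ∈ M, ∃ M' : Set (Fin 2 → ℂ), IsRealAnalyticHypersurface M' ∧
    ∃ h : OpenPartialHomeomorph C3 ((Fin 2 → ℂ) × ℂ), p ∈ h.source ∧
      DifferentiableOn ℂ h h.source ∧ DifferentiableOn ℂ h.symm h.target ∧
      h '' (M ∩ h.source) = (M' ×ˢ (univ : Set ℂ)) ∩ h.target

end CRGeom

end

open Set Filter Topology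

noncomputable section

namespace CRGeom

/-! ### Complexification of real-linear maps and of real-analytic functions -/

section Complexification

variable {F : Type*} [NormedAddCommGroup F] [NormedSpace ℂ F]

/-! Near a point of M, a real-analytic defining function r extends to a holomorphic function R(z, ζ)
on ℂ³ × ℂ³ with r(z) = R(z, z̄). A vector (a, 0) has type (1,0) when dR(a, 0) = 0, and
differentiating this relation along M turns the Levi form into the mixed Hessian `hess R`
(`bracket_mem_iff`, `mem_K10_iff`).

From a product to the Freeman form: the coordinate field of the factor ℂ pulls back to a
nonvanishing holomorphic field k tangent to M. Conjugate derivatives of dR(k, 0) = 0 do not see k,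
so k lies in the Levi kernel, which is a line by the rank hypothesis. A section of the kernel is
then f k along M, and L̄(f k) = (L̄ f) k lies in the kernel again.

From the Freeman form to a product: the Levi kernel is spanned by a real-analytic field K with ξ(K)
= 1 for a fixed linear form ξ (`exists_kernel_field`). The vanishing of the Freeman form puts L̄ K
in the kernel line, the normalization puts it in ker ξ, so L̄ K = 0. By the identity principle
`eventually_eq_zero_of_restrict`, the holomorphic extension κ of K has zero derivative, on the
complexification {R = 0}, in the tangent directions (0, b). Solving R(z, s + θ(z, s) v) = 0 gives
holomorphic functions θ(·, s) whose zero sets are the Segre varieties of M. Since κ is constant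
along the slices of {R = 0} with z fixed, K annihilates every θ(·, s) at the points of M. Two of
these functions, chosen thanks to the nonzero Levi form, together with ξ are holomorphic coordinates
in which K is the last coordinate direction (`exists_straightening_coordinates`). There M is tangent
to that complex direction at each of its points, hence locally invariant under translations along it
(`exists_ball_zero_invariant`), which is the product structure. -/

lemma norm_complexify_le (φ : C3 →L[ℝ] F) (Z : CVec) : ‖complexify φ Z‖ ≤ 2 * ‖φ‖ * ‖Z‖ := by
  have h : ∀ x : C3, ‖x‖ ≤ ‖Z‖ → ‖φ x‖ ≤ ‖φ‖ * ‖Z‖ := fun x hx =>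
    (φ.le_opNorm x).trans (by gcongr)
  have h1 : ‖Z.1‖ ≤ ‖Z‖ := norm_fst_le Z
  have h2 : ‖star Z.2‖ ≤ ‖Z‖ := by rw [norm_star]; exact norm_snd_le Z
  have h3 : ‖Complex.I • Z.1‖ ≤ ‖Z‖ := by rw [norm_smul]; simpa using h1
  have h4 : ‖Complex.I • star Z.2‖ ≤ ‖Z‖ := by rw [norm_smul]; simpa using h2
  have e1 := h _ h1
  have e2 := h _ h2
  have e3 := h _ h3
  have e4 := h _ h4
  unfold complexify
  refine (norm_add_le _ _).trans ?_
  rw [norm_smul, norm_smul]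
  have a1 := norm_sub_le (φ Z.1) (Complex.I • φ (Complex.I • Z.1))
  have a2 := norm_add_le (φ (star Z.2)) (Complex.I • φ (Complex.I • star Z.2))
  rw [norm_smul, Complex.norm_I, one_mul] at a1 a2
  have : ‖(1 / 2 : ℂ)‖ = 1 / 2 := by norm_num
  rw [this]
  linarith

/-- The `ℂ`-linear extension of an `ℝ`-linear map, as a continuous linear map depending
`ℝ`-linearly on it. -/
def complexifyL (F : Type*) [NormedAddCommGroup F] [NormedSpace ℂ F] :
    (C3 →L[ℝ] F) →L[ℝ] (CVec →L[ℂ] F) :=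
  LinearMap.mkContinuous
    { toFun := fun φ => LinearMap.mkContinuous
        { toFun := complexify φ
          map_add' := complexify_add φ
          map_smul' := complexify_smul φ } (2 * ‖φ‖) (norm_complexify_le φ)
      map_add' := fun φ ψ => by
        ext Z <;> simp [complexify] <;> module
      map_smul' := fun c φ => by
        have key : ∀ Z, complexify (c • φ) Z = c • complexify φ Z := fun Z => by
          simp only [complexify, smul_apply, ← Complex.coe_smul]
          module
        exact ContinuousLinearMap.ext key }
    2 fun φ => LinearMap.mkContinuous_norm_le _ (by positivity) (norm_complexify_le φ)

lemma complexifyL_apply (φ : C3 →L[ℝ] F) (Z : CVec) : complexifyL F φ Z = complexify φ Z := rfl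

lemma norm_complexifyL_le : ‖complexifyL F‖ ≤ 2 :=
  LinearMap.mkContinuous_norm_le _ (by norm_num)
    fun φ => LinearMap.mkContinuous_norm_le _ (by positivity) (norm_complexify_le φ)

lemma complexify_realVec (φ : C3 →L[ℝ] F) (x : C3) : complexify φ (realVec x) = φ x := by
  simp only [complexify, realVec, star_star]
  module

/-- Every vector of `ℂ ⊗ T ℂ³` has a real and an imaginary part. -/
lemma exists_realVec_add (Z : CVec) : ∃ x y : C3, Z = realVec x + Complex.I • realVec y := by
  refine ⟨(1 / 2 : ℂ) • (Z.1 + star Z.2), (-Complex.I / 2) • (Z.1 - star Z.2), ?_⟩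
  have hI := Complex.I_mul_I
  refine Prod.ext ?_ ?_ <;> ext j
  · simp [realVec]
    linear_combination ((1 / 2 : ℂ) * (Z.1 j - (starRingEnd ℂ) (Z.2 j))) * hI
  · simp [realVec]
    linear_combination ((1 / 2 : ℂ) * (Z.2 j - (starRingEnd ℂ) (Z.1 j))) * hI

lemma complexify_eq_of_realVec (φ : C3 →L[ℝ] F) (A : CVec →L[ℂ] F)
    (h : ∀ x, A (realVec x) = φ x) (Z : CVec) : complexify φ Z = A Z := by
  obtain ⟨x, y, rfl⟩ := exists_realVec_add Z
  rw [complexify_add, complexify_smul, complexify_realVec, complexify_realVec, map_add, map_smul,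
    h, h]

/-- The slots are complexified one at a time by `complexifyL`. Each costs a factor 2 in norm, so the
growth is only geometric and power series keep a positive radius of convergence. -/
lemma exists_multilinear_complexification (n : ℕ) :
    ∃ C : (C3 [×n]→L[ℝ] F) →L[ℝ] (CVec [×n]→L[ℂ] F), ‖C‖ ≤ 2 ^ n ∧
      ∀ φ x, C φ (fun i => realVec (x i)) = φ x := by
  induction n with
  | zero =>
    let C : (C3 [×0]→L[ℝ] F) →L[ℝ] (CVec [×0]→L[ℂ] F) :=
      ((continuousMultilinearCurryFin0 ℂ CVec F).symm.toContinuousLinearEquiv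
        |>.toContinuousLinearMap.restrictScalars ℝ).comp
      (continuousMultilinearCurryFin0 ℝ C3 F).toContinuousLinearEquiv.toContinuousLinearMap
    refine ⟨C, ?_, ?_⟩
    · refine C.opNorm_le_bound (by norm_num) fun φ => ?_
      have h : ‖C φ‖ = ‖φ‖ :=
        ((continuousMultilinearCurryFin0 ℂ CVec F).symm.norm_map _).trans
          ((continuousMultilinearCurryFin0 ℝ C3 F).norm_map φ)
      rw [h]; simp
    · intro φ x
      have : x = 0 := Subsingleton.elim _ _
      subst this
      rfl
  | succ n ih =>
    obtain ⟨C, hC, hCx⟩ := ih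
    let D : (C3 [×(n + 1)]→L[ℝ] F) →L[ℝ] (CVec [×(n + 1)]→L[ℂ] F) :=
      ((continuousMultilinearCurryLeftEquiv ℂ (fun _ : Fin (n + 1) => CVec) F).symm
        |>.toContinuousLinearEquiv.toContinuousLinearMap.restrictScalars ℝ).comp
      ((complexifyL (CVec [×n]→L[ℂ] F)).comp
      ((ContinuousLinearMap.compL ℝ C3 (C3 [×n]→L[ℝ] F) (CVec [×n]→L[ℂ] F) C).comp
      (continuousMultilinearCurryLeftEquiv ℝ (fun _ : Fin (n + 1) => C3) F
        |>.toContinuousLinearEquiv.toContinuousLinearMap)))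
    have hD : ∀ φ, D φ = ContinuousLinearMap.uncurryLeft
        (complexifyL (CVec [×n]→L[ℂ] F) (C.comp φ.curryLeft)) := fun φ => rfl
    refine ⟨D, ?_, ?_⟩
    · refine D.opNorm_le_bound (by positivity) fun φ => ?_
      rw [hD, ContinuousLinearMap.uncurryLeft_norm]
      calc _ ≤ ‖complexifyL (CVec [×n]→L[ℂ] F)‖ * ‖C.comp φ.curryLeft‖ :=
            ContinuousLinearMap.le_opNorm _ _
        _ ≤ 2 * (‖C‖ * ‖φ.curryLeft‖) := by
            gcongr
            · exact norm_complexifyL_le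
            · exact ContinuousLinearMap.opNorm_comp_le _ _
        _ ≤ 2 * (2 ^ n * ‖φ‖) := by
            rw [ContinuousMultilinearMap.curryLeft_norm]
            gcongr
        _ = _ := by ring
    · intro φ x
      rw [hD, ContinuousLinearMap.uncurryLeft_apply, complexifyL_apply, complexify_realVec]
      have := hCx (φ.curryLeft (x 0)) (Fin.tail x)
      simp only [ContinuousLinearMap.comp_apply]
      refine this.trans ?_
      rw [ContinuousMultilinearMap.curryLeft_apply, Fin.cons_self_tail]

lemma realVec_add (x y : C3) : realVec (x + y) = realVec x + realVec y := by
  simp [realVec]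

lemma realVec_sub (x y : C3) : realVec (x - y) = realVec x - realVec y := by
  simp [realVec]

lemma realVec_smul (c : ℝ) (x : C3) : realVec (c • x) = c • realVec x := by
  refine Prod.ext rfl ?_
  ext j
  simp [realVec]

lemma norm_realVec (x : C3) : ‖realVec x‖ = ‖x‖ := by
  simp [realVec, Prod.norm_def, norm_star]

/-- `realVec` as a continuous `ℝ`-linear map. -/
def realVecL : C3 →L[ℝ] CVec :=
  LinearMap.mkContinuous
    { toFun := realVec, map_add' := realVec_add, map_smul' := realVec_smul } 1
    fun x => by simp [norm_realVec]

lemma continuous_realVec : Continuous realVec := realVecL.continuous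

/-- A real-analytic function near `p ∈ ℂ³` is the restriction to the real points of a holomorphic
function of twice as many variables. -/
theorem exists_holomorphic_extension [CompleteSpace F] {f : C3 → F} {p : C3}
    (hf : AnalyticAt ℝ f p) :
    ∃ H : CVec → F, AnalyticAt ℂ H (realVec p) ∧ ∀ᶠ x in 𝓝 p, H (realVec x) = f x := by
  obtain ⟨q, hq⟩ := hf
  obtain ⟨r, hr⟩ := hq
  choose C hC hCx using fun n => exists_multilinear_complexification (F := F) n
  let Q : FormalMultilinearSeries ℂ CVec F := fun n => C n (q n)
  obtain ⟨s, hs0, hsr⟩ := ENNReal.lt_iff_exists_nnreal_btwn.1 (hr.r_pos.trans_le hr.r_le)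
  obtain ⟨K, hK, hKn⟩ := q.norm_mul_pow_le_of_lt_radius hsr
  have hs : 0 < s := by exact_mod_cast hs0
  -- Halving the radius absorbs the factor `2 ^ n` from the complexification of the degree `n` term.
  have hrad : ((s / 2 : NNReal) : ENNReal) ≤ Q.radius := by
    refine Q.le_radius_of_bound K fun n => ?_
    calc ‖Q n‖ * ((s / 2 : NNReal) : ℝ) ^ n ≤ (2 ^ n * ‖q n‖) * ((s / 2 : NNReal) : ℝ) ^ n := by
          gcongr
          exact ((C n).le_opNorm _).trans (by gcongr; exact hC n)
      _ = ‖q n‖ * (s : ℝ) ^ n := by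
          push_cast
          rw [div_pow]
          field_simp
      _ ≤ K := hKn n
  have hpos : 0 < Q.radius := lt_of_lt_of_le (by simpa using hs.ne') hrad
  have hQ := Q.hasFPowerSeriesOnBall hpos
  refine ⟨fun Z => Q.sum (Z - realVec p), ?_, ?_⟩
  · have h0 : AnalyticAt ℂ Q.sum (realVec p - realVec p) := by
      rw [sub_self]; exact hQ.analyticAt
    exact h0.comp_of_eq (analyticAt_id.sub analyticAt_const) rfl
  · have h1 : ∀ᶠ x in 𝓝 p, x ∈ Metric.eball p r := Metric.eball_mem_nhds p hr.r_pos
    filter_upwards [h1] with x hx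
    have hx' : HasSum (fun n => q n fun _ => x - p) (f x) := by
      have := hr.hasSum_sub (y := x) hx
      exact this
    have e : ∀ n, Q n (fun _ => realVec x - realVec p) = q n fun _ => x - p := fun n => by
      rw [← realVec_sub]
      exact hCx n (q n) fun _ => x - p
    show (∑' n, Q n fun _ => realVec x - realVec p) = f x
    simp only [e]
    exact hx'.tsum_eq

/-- Both sides are ℂ-linear in `Z` and agree on real vectors by the chain rule. Thus ∂̄-derivatives
of `f` become derivatives of `H` in the second group of variables. -/
lemma complexify_fderiv {f : C3 → F} {H : CVec → F} {x : C3}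
    (hH : DifferentiableAt ℂ H (realVec x)) (hf : ∀ᶠ y in 𝓝 x, H (realVec y) = f y) (Z : CVec) :
    complexify (fderiv ℝ f x) Z = fderiv ℂ H (realVec x) Z := by
  have h1 : HasFDerivAt f (((fderiv ℂ H (realVec x)).restrictScalars ℝ).comp realVecL) x := by
    have h2 : HasFDerivAt (fun y => H (realVecL y))
        (((fderiv ℂ H (realVec x)).restrictScalars ℝ).comp realVecL) x :=
      (hH.hasFDerivAt.restrictScalars ℝ).comp x realVecL.hasFDerivAt
    exact h2.congr_of_eventuallyEq (hf.mono fun y hy => hy.symm)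
  refine complexify_eq_of_realVec _ _ (fun y => ?_) Z
  rw [h1.fderiv]
  rfl

end Complexification

/-! ### Straightening a function with nonvanishing differential -/

section Straightening

open scoped ContDiff

/-- A local change of coordinates in which a function with nonvanishing differential becomes
linear. -/
theorem exists_straightening {𝕜 E : Type*} [RCLike 𝕜] [NormedAddCommGroup E] [NormedSpace 𝕜 E]
    [CompleteSpace E] {f : E → 𝕜} {p v : E} (hf : ContDiffAt 𝕜 ω f p) (h0 : f p = 0)
    (hv : fderiv 𝕜 f p v = 1) :
    ∃ e : OpenPartialHomeomorph E E, (∀ x, e x = x + (f x - fderiv 𝕜 f p (x - p)) • v) ∧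
      p ∈ e.source ∧ e p = p ∧ ContDiffAt 𝕜 ω e.symm p ∧
      HasFDerivAt e.symm (ContinuousLinearMap.id 𝕜 E) p ∧
      ∀ x, fderiv 𝕜 f p (e x - p) = f x := by
  -- `Φ` moves `x` along `v` by the nonlinear part of `f`: it has identity derivative at `p`, and
  -- the linear part of `f` evaluated on `Φ x - p` is `f x` because `v` is normalized.
  let Φ : E → E := fun x => x + (f x - fderiv 𝕜 f p (x - p)) • v
  have hΦ : ContDiffAt 𝕜 ω Φ p := by
    refine contDiffAt_id.add (ContDiffAt.smul (hf.sub ?_) contDiffAt_const)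
    exact (fderiv 𝕜 f p).contDiff.contDiffAt.comp p (contDiffAt_id.sub contDiffAt_const)
  have hd : DifferentiableAt 𝕜 f p := hf.differentiableAt (by simp)
  have hΦ' : HasFDerivAt Φ ((ContinuousLinearEquiv.refl 𝕜 E : E ≃L[𝕜] E) : E →L[𝕜] E) p := by
    have h1 : HasFDerivAt (fun x => f x - fderiv 𝕜 f p (x - p))
        (fderiv 𝕜 f p - fderiv 𝕜 f p) p := by
      refine hd.hasFDerivAt.sub ?_
      exact (fderiv 𝕜 f p).hasFDerivAt.comp p ((hasFDerivAt_id p).sub_const p)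
    have h2 := (hasFDerivAt_id p).add (h1.smul_const v)
    refine h2.congr_fderiv ?_
    ext x
    simp
  have hn : (ω : WithTop ℕ∞) ≠ 0 := by simp
  let e := hΦ.toOpenPartialHomeomorph Φ hΦ' hn
  have hep : Φ p = p := by simp [Φ, h0]
  have hsrc : p ∈ e.source := hΦ.mem_toOpenPartialHomeomorph_source hΦ' hn
  have hsymm : e.symm p = p := by
    have := e.left_inv hsrc
    rwa [show e p = p from hep] at this
  have htgt : p ∈ e.target := by
    have := e.map_source hsrc
    rwa [show e p = p from hep] at this
  refine ⟨e, fun x => rfl, hsrc, hep, ?_, ?_, fun x => ?_⟩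
  · have := hΦ.to_localInverse hΦ' hn
    rw [hep] at this
    exact this
  · have := e.hasFDerivAt_symm (f' := ContinuousLinearEquiv.refl 𝕜 E) htgt
      (by rw [hsymm]; exact hΦ')
    exact this
  · show fderiv 𝕜 f p (x + (f x - fderiv 𝕜 f p (x - p)) • v - p) = f x
    rw [add_sub_right_comm, map_add, map_smul, hv]
    simp

end Straightening

/-! ### Defining functions and the tangent spaces they cut out -/

/-- `r` is a real-analytic defining function of `M` near `q`, and `R` its holomorphic extension. -/
structure IsDefining (M : Set C3) (r : C3 → ℝ) (R : CVec → ℂ) (q : C3) : Prop where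
  analyticAt_real : AnalyticAt ℝ r q
  fderiv_ne_zero : fderiv ℝ r q ≠ 0
  mem_iff : ∀ᶠ x in 𝓝 q, (x ∈ M ↔ r x = 0)
  analyticAt : AnalyticAt ℂ R (realVec q)
  restrict : ∀ᶠ x in 𝓝 q, R (realVec x) = (r x : ℂ)

lemma IsRealAnalyticHypersurface.exists_isDefining {M : Set C3}
    (hM : IsRealAnalyticHypersurface M) {p : C3} (hp : p ∈ M) : ∃ r R, IsDefining M r R p := by
  obtain ⟨r, hr, hr', hrM⟩ := hM p hp
  have hc : AnalyticAt ℝ (fun x => (r x : ℂ)) p :=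
    (Complex.ofRealCLM.analyticAt (r p)).comp hr
  obtain ⟨R, hR, hRr⟩ := exists_holomorphic_extension hc
  exact ⟨r, R, hr, hr', hrM, hR, hRr⟩

namespace IsDefining

variable {M : Set C3} {r : C3 → ℝ} {R : CVec → ℂ} {q : C3}

lemma eventually (h : IsDefining M r R q) : ∀ᶠ x in 𝓝 q, IsDefining M r R x := by
  have h1 : ∀ᶠ x in 𝓝 q, fderiv ℝ r x ≠ 0 :=
    h.analyticAt_real.fderiv.continuousAt.eventually_ne h.fderiv_ne_zero
  have h2 : ∀ᶠ x in 𝓝 q, AnalyticAt ℂ R (realVec x) :=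
    continuous_realVec.continuousAt.eventually h.analyticAt.eventually_analyticAt
  filter_upwards [h.analyticAt_real.eventually_analyticAt, h1,
    eventually_eventually_nhds.2 h.mem_iff, h2, eventually_eventually_nhds.2 h.restrict]
    with x a b c d e using ⟨a, b, c, d, e⟩

lemma apply_eq_zero (h : IsDefining M r R q) (hq : q ∈ M) : r q = 0 :=
  h.mem_iff.self_of_nhds.1 hq

lemma complexify_fderiv_eq (h : IsDefining M r R q) (Z : CVec) :
    complexify (Complex.ofRealCLM.comp (fderiv ℝ r q)) Z = fderiv ℂ R (realVec q) Z := by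
  rw [← complexify_fderiv h.analyticAt.differentiableAt h.restrict]
  congr 1
  exact ((Complex.ofRealCLM.hasFDerivAt (x := r q)).comp q
    h.analyticAt_real.differentiableAt.hasFDerivAt).fderiv.symm

lemma fderiv_realVec (h : IsDefining M r R q) (x : C3) :
    fderiv ℂ R (realVec q) (realVec x) = (fderiv ℝ r q x : ℂ) := by
  rw [← h.complexify_fderiv_eq, complexify_realVec]
  rfl

lemma fderiv_inl (h : IsDefining M r R q) (a : C3) :
    fderiv ℂ R (realVec q) (a, 0) =
      (1 / 2 : ℂ) * (fderiv ℝ r q a - Complex.I * fderiv ℝ r q (Complex.I • a)) := by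
  rw [← h.complexify_fderiv_eq]
  simp [complexify]

/-- Reality of `r`: its ∂̄-differential is the conjugate of its ∂-differential. -/
lemma fderiv_inr_star (h : IsDefining M r R q) (a : C3) :
    fderiv ℂ R (realVec q) (0, star a) = star (fderiv ℂ R (realVec q) (a, 0)) := by
  rw [h.fderiv_inl, ← h.complexify_fderiv_eq]
  simp [complexify]

lemma fderiv_inr_eq_zero_iff (h : IsDefining M r R q) (b : C3) :
    fderiv ℂ R (realVec q) (0, b) = 0 ↔ fderiv ℂ R (realVec q) (star b, 0) = 0 := by
  have := h.fderiv_inr_star (star b)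
  rw [star_star] at this
  rw [this, star_eq_zero]

lemma fderiv_inl_eq_zero_iff (h : IsDefining M r R q) (a : C3) :
    fderiv ℂ R (realVec q) (a, 0) = 0 ↔
      fderiv ℝ r q a = 0 ∧ fderiv ℝ r q (Complex.I • a) = 0 := by
  rw [h.fderiv_inl]
  constructor
  · intro e
    have e1 := congrArg Complex.re e
    have e2 := congrArg Complex.im e
    simp at e1 e2
    exact ⟨e1, e2⟩
  · rintro ⟨e1, e2⟩
    simp [e1, e2]

/-- The real and imaginary parts of a vector annihilated by the differential of the defining
function. -/
lemma exists_realVec_of_fderiv_eq_zero (h : IsDefining M r R q) {Z : CVec}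
    (hZ : fderiv ℂ R (realVec q) Z = 0) :
    ∃ x y : C3, Z = realVec x + Complex.I • realVec y ∧ fderiv ℝ r q x = 0 ∧ fderiv ℝ r q y = 0 := by
  obtain ⟨x, y, rfl⟩ := exists_realVec_add Z
  refine ⟨x, y, rfl, ?_⟩
  rw [map_add, map_smul, h.fderiv_realVec, h.fderiv_realVec] at hZ
  have e1 := congrArg Complex.re hZ
  have e2 := congrArg Complex.im hZ
  simp at e1 e2
  exact ⟨e1, e2⟩

lemma exists_fderiv_eq_one (h : IsDefining M r R q) : ∃ v, fderiv ℝ r q v = 1 := by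
  obtain ⟨v, hv⟩ : ∃ v, fderiv ℝ r q v ≠ 0 := by
    by_contra! hc
    exact h.fderiv_ne_zero (ContinuousLinearMap.ext hc)
  exact ⟨(fderiv ℝ r q v)⁻¹ • v, by simp [hv]⟩

lemma exists_fderiv_inl_eq_one (h : IsDefining M r R q) :
    ∃ a, fderiv ℂ R (realVec q) (a, 0) = 1 := by
  obtain ⟨v, hv⟩ := h.exists_fderiv_eq_one
  have hne : fderiv ℂ R (realVec q) (v, 0) ≠ 0 := fun e => by
    have := ((h.fderiv_inl_eq_zero_iff v).1 e).1
    rw [hv] at this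
    exact one_ne_zero this
  refine ⟨(fderiv ℂ R (realVec q) (v, 0))⁻¹ • v, ?_⟩
  have : (((fderiv ℂ R (realVec q) (v, 0))⁻¹ • v, 0) : CVec) =
      (fderiv ℂ R (realVec q) (v, 0))⁻¹ • (v, 0) := by simp
  rw [this, map_smul, smul_eq_mul, inv_mul_cancel₀ hne]

/-- A function vanishing on `M` has vanishing derivative in the directions annihilated by the
differential of the defining function. -/
lemma fderiv_eq_zero_of_tangent {G : Type*} [NormedAddCommGroup G] [NormedSpace ℝ G]
    (h : IsDefining M r R q) (hq : q ∈ M) {f : C3 → G} (hf : DifferentiableAt ℝ f q)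
    (hf0 : ∀ᶠ x in 𝓝[M] q, f x = 0) {x : C3} (hx : fderiv ℝ r q x = 0) :
    fderiv ℝ f q x = 0 := by
  obtain ⟨v, hv⟩ := h.exists_fderiv_eq_one
  obtain ⟨e, -, hes, hep, hec, hed, her⟩ :=
    exists_straightening h.analyticAt_real.contDiffAt (h.apply_eq_zero hq) hv
  have hsymm : e.symm q = q := by
    have := e.left_inv hes
    rwa [hep] at this
  have htgt : q ∈ e.target := by
    have := e.map_source hes
    rwa [hep] at this
  -- A line in the hyperplane tangent to `M`, bent back by the inverse chart, stays in `M`; its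
  -- velocity is still `x`, the chart having identity derivative at `q`.
  let c : ℝ → C3 := fun t => e.symm (q + t • x)
  have hline : HasDerivAt (fun t : ℝ => q + t • x) x 0 := by
    simpa using ((hasDerivAt_id (0 : ℝ)).smul_const x).const_add q
  have hc0 : c 0 = q := by simp [c, hsymm]
  have hc : HasDerivAt c x 0 := by
    have := HasFDerivAt.comp_hasDerivAt (x := (0 : ℝ)) (l := e.symm)
      (l' := ContinuousLinearMap.id ℝ C3) (f := fun t : ℝ => q + t • x) (f' := x)
      (by simpa using hed) hline
    exact this
  have hcont : Tendsto c (𝓝 0) (𝓝 q) := by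
    have := hc.continuousAt.tendsto
    rwa [hc0] at this
  have hmem : ∀ᶠ t in 𝓝 (0 : ℝ), c t ∈ M := by
    have h1 : ∀ᶠ t in 𝓝 (0 : ℝ), q + t • x ∈ e.target := by
      refine hline.continuousAt.eventually ?_
      simpa using e.open_target.mem_nhds htgt
    filter_upwards [hcont.eventually h.mem_iff, h1] with t ht ht'
    rw [ht, ← her, e.right_inv ht']
    simp [hx]
  have hz : ∀ᶠ t in 𝓝 (0 : ℝ), f (c t) = 0 := by
    rw [eventually_nhdsWithin_iff] at hf0
    filter_upwards [hcont.eventually hf0, hmem] with t h1 h2 using h1 h2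
  have hd : HasDerivAt (fun t => f (c t)) (fderiv ℝ f q x) 0 :=
    HasFDerivAt.comp_hasDerivAt (x := (0 : ℝ)) (by rw [hc0]; exact hf.hasFDerivAt) hc
  have hd0 : HasDerivAt (fun t => f (c t)) 0 0 :=
    (hasDerivAt_const (0 : ℝ) (0 : G)).congr_of_eventuallyEq hz
  exact hd.unique hd0

lemma complexify_fderiv_eq_zero {F : Type*} [NormedAddCommGroup F] [NormedSpace ℂ F]
    (h : IsDefining M r R q) (hq : q ∈ M) {f : C3 → F} (hf : DifferentiableAt ℝ f q)
    (hf0 : ∀ᶠ x in 𝓝[M] q, f x = 0) {Z : CVec} (hZ : fderiv ℂ R (realVec q) Z = 0) :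
    complexify (fderiv ℝ f q) Z = 0 := by
  obtain ⟨x, y, rfl, hx, hy⟩ := h.exists_realVec_of_fderiv_eq_zero hZ
  rw [complexify_add, complexify_smul, complexify_realVec, complexify_realVec,
    h.fderiv_eq_zero_of_tangent hq hf hf0 hx, h.fderiv_eq_zero_of_tangent hq hf hf0 hy]
  simp

lemma mem_tangentSpace_iff (h : IsDefining M r R q) (hq : q ∈ M) {x : C3} :
    x ∈ tangentSpace M q ↔ fderiv ℝ r q x = 0 := by
  constructor
  · intro hx
    refine hx r h.analyticAt_real ?_
    rw [eventually_nhdsWithin_iff]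
    filter_upwards [h.mem_iff] with y hy using hy.1
  · intro hx f hf hf0
    exact h.fderiv_eq_zero_of_tangent hq hf.differentiableAt hf0 hx

lemma mem_maximalComplexSubspace_iff (h : IsDefining M r R q) (hq : q ∈ M) {x : C3} :
    x ∈ maximalComplexSubspace M q ↔ fderiv ℂ R (realVec q) (x, 0) = 0 := by
  rw [h.fderiv_inl_eq_zero_iff, ← h.mem_tangentSpace_iff hq, ← h.mem_tangentSpace_iff hq]
  rfl

lemma mem_T10_iff (h : IsDefining M r R q) (hq : q ∈ M) {Z : CVec} :
    Z ∈ T10 M q ↔ Z.2 = 0 ∧ fderiv ℂ R (realVec q) (Z.1, 0) = 0 := by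
  simp only [T10, Submodule.mem_map, LinearMap.inl_apply]
  constructor
  · rintro ⟨y, hy, rfl⟩
    exact ⟨rfl, (h.mem_maximalComplexSubspace_iff hq).1 hy⟩
  · rintro ⟨h1, h2⟩
    exact ⟨Z.1, (h.mem_maximalComplexSubspace_iff hq).2 h2, Prod.ext rfl h1.symm⟩

lemma mem_T01_iff (h : IsDefining M r R q) (hq : q ∈ M) {Z : CVec} :
    Z ∈ T01 M q ↔ Z.1 = 0 ∧ fderiv ℂ R (realVec q) (0, Z.2) = 0 := by
  rw [T01, Submodule.mem_comap, h.mem_T10_iff hq, h.fderiv_inr_eq_zero_iff]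
  simp [conjVec]

lemma mem_T10_sup_T01_iff (h : IsDefining M r R q) (hq : q ∈ M) {Z : CVec} :
    Z ∈ T10 M q ⊔ T01 M q ↔
      fderiv ℂ R (realVec q) (Z.1, 0) = 0 ∧ fderiv ℂ R (realVec q) (0, Z.2) = 0 := by
  rw [Submodule.mem_sup]
  constructor
  · rintro ⟨y, hy, z, hz, rfl⟩
    rw [h.mem_T10_iff hq] at hy
    rw [h.mem_T01_iff hq] at hz
    simp [hy.1, hy.2, hz.1, hz.2]
  · rintro ⟨h1, h2⟩
    exact ⟨(Z.1, 0), (h.mem_T10_iff hq).2 ⟨rfl, h1⟩, (0, Z.2), (h.mem_T01_iff hq).2 ⟨rfl, h2⟩,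
      by simp⟩

lemma mem_complexTangentSpace (h : IsDefining M r R q) (hq : q ∈ M) {Z : CVec}
    (hZ : fderiv ℂ R (realVec q) Z = 0) : Z ∈ complexTangentSpace M q := by
  obtain ⟨x, y, rfl, hx, hy⟩ := h.exists_realVec_of_fderiv_eq_zero hZ
  have hs : ∀ z, fderiv ℝ r q z = 0 → realVec z ∈ complexTangentSpace M q := fun z hz =>
    Submodule.subset_span ⟨z, (h.mem_tangentSpace_iff hq).2 hz, rfl⟩
  exact add_mem (hs x hx) (Submodule.smul_mem _ _ (hs y hy))

end IsDefining

/-! ### Brackets, the mixed Hessian and the Levi kernel -/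

lemma map_complexify {F G : Type*} [NormedAddCommGroup F] [NormedSpace ℂ F] [NormedAddCommGroup G]
    [NormedSpace ℂ G] (A : F →L[ℂ] G) (φ : C3 →L[ℝ] F) (Z : CVec) :
    A (complexify φ Z) = complexify ((A.restrictScalars ℝ).comp φ) Z := by
  simp [complexify]

lemma map_complexify_fderiv {F G : Type*} [NormedAddCommGroup F] [NormedSpace ℂ F]
    [NormedAddCommGroup G] [NormedSpace ℂ G] (A : F →L[ℂ] G) {f : C3 → F} {q : C3}
    (hf : DifferentiableAt ℝ f q) (Z : CVec) :
    A (complexify (fderiv ℝ f q) Z) = complexify (fderiv ℝ (fun x => A (f x)) q) Z := by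
  rw [map_complexify]
  congr 1
  exact ((A.restrictScalars ℝ).hasFDerivAt.comp q hf.hasFDerivAt).fderiv.symm

lemma analyticAt_star {f : C3 → C3} {q : C3} (hf : AnalyticAt ℝ f q) :
    AnalyticAt ℝ (fun x => star (f x)) q := by
  have h : AnalyticAt ℝ (fun x => (starL' ℝ : C3 ≃L[ℝ] C3) (f x)) q :=
    ((starL' ℝ : C3 ≃L[ℝ] C3).toContinuousLinearMap.analyticAt _).comp hf
  exact h

lemma analyticAt_fst_comp {L : C3 → CVec} {q : C3} (hL : AnalyticAt ℝ L q) :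
    AnalyticAt ℝ (fun x => (L x).1) q :=
  analyticAt_fst.comp hL

lemma analyticAt_snd_comp {L : C3 → CVec} {q : C3} (hL : AnalyticAt ℝ L q) :
    AnalyticAt ℝ (fun x => (L x).2) q :=
  analyticAt_snd.comp hL

lemma analyticAt_conjField {L : C3 → CVec} {q : C3} (hL : AnalyticAt ℝ L q) :
    AnalyticAt ℝ (conjField L) q :=
  (analyticAt_star (analyticAt_snd_comp hL)).prod (analyticAt_star (analyticAt_fst_comp hL))

lemma analyticAt_comp_realVec {F : Type*} [NormedAddCommGroup F] [NormedSpace ℂ F]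
    {H : CVec → F} {q : C3} (h : AnalyticAt ℂ H (realVec q)) :
    AnalyticAt ℝ (fun x => H (realVec x)) q :=
  (h.restrictScalars (𝕜 := ℝ)).comp_of_eq (realVecL.analyticAt q) rfl

/-- The second derivative `∂²R` at the real point `q`. Its value on `(0, b)`, `(a, 0)` is the Levi
form of the defining function. -/
def hess (R : CVec → ℂ) (q : C3) : CVec →L[ℂ] CVec →L[ℂ] ℂ :=
  fderiv ℂ (fderiv ℂ R) (realVec q)

namespace IsDefining

variable {M : Set C3} {r : C3 → ℝ} {R : CVec → ℂ} {q : C3}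

lemma hess_symm (h : IsDefining M r R q) (Z W : CVec) : hess R q Z W = hess R q W Z :=
  h.analyticAt.contDiffAt.isSymmSndFDerivAt (n := ⊤) le_top Z W

/-- The product rule applied to dR(A l) = 0 along `M`, in a direction of the complexified tangent
space. The map `A` is `inl` for (1,0) fields and `inr` for (0,1) fields. -/
lemma hess_add_eq_zero (h : IsDefining M r R q) (hq : q ∈ M) (A : C3 →L[ℂ] CVec) {l : C3 → C3}
    (hl : DifferentiableAt ℝ l q)
    (hl0 : ∀ᶠ x in 𝓝[M] q, fderiv ℂ R (realVec x) (A (l x)) = 0) {Z : CVec}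
    (hZ : fderiv ℂ R (realVec q) Z = 0) :
    hess R q Z (A (l q)) + fderiv ℂ R (realVec q) (A (complexify (fderiv ℝ l q) Z)) = 0 := by
  have hd : HasFDerivAt (fun x => fderiv ℂ R (realVecL x))
      (((hess R q).restrictScalars ℝ).comp realVecL) q :=
    HasFDerivAt.comp q
      (h.analyticAt.fderiv.differentiableAt.hasFDerivAt.restrictScalars ℝ) realVecL.hasFDerivAt
  have hA : HasFDerivAt (fun x => A (l x)) ((A.restrictScalars ℝ).comp (fderiv ℝ l q)) q :=
    (A.restrictScalars ℝ).hasFDerivAt.comp q hl.hasFDerivAt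
  let ev : (CVec →L[ℂ] ℂ) →L[ℝ] CVec →L[ℝ] ℂ :=
    ContinuousLinearMap.restrictScalarsL ℂ CVec ℂ ℝ ℝ
  have hd' : HasFDerivAt (fun x => ev (fderiv ℂ R (realVecL x)))
      (ev.comp (((hess R q).restrictScalars ℝ).comp realVecL)) q :=
    ev.hasFDerivAt.comp q hd
  have hf := hd'.clm_apply hA
  have h0 := h.complexify_fderiv_eq_zero hq hf.differentiableAt hl0 hZ
  rw [hf.fderiv] at h0
  rw [complexify_eq_of_realVec _ ((hess R q).flip (A (l q)) +
    (fderiv ℂ R (realVec q)).comp (A.comp (complexifyL C3 (fderiv ℝ l q))))] at h0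
  · exact h0
  · intro x
    simp only [add_apply, ContinuousLinearMap.comp_apply, complexifyL_apply, complexify_realVec]
    rw [add_comm]
    rfl

lemma section_snd_eq_zero (h : IsDefining M r R q) {L : C3 → CVec}
    (hL : IsLocalSection M (T10 M) q L) :
    ∀ᶠ x in 𝓝[M] q, (L x).2 = 0 ∧ fderiv ℂ R (realVec x) ((L x).1, 0) = 0 := by
  filter_upwards [hL.2, nhdsWithin_le_nhds h.eventually, self_mem_nhdsWithin] with x h1 h2 h3
  exact (h2.mem_T10_iff h3).1 h1

lemma section_apply (h : IsDefining M r R q) (hq : q ∈ M) {L : C3 → CVec}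
    (hL : IsLocalSection M (T10 M) q L) :
    (L q).2 = 0 ∧ fderiv ℂ R (realVec q) ((L q).1, 0) = 0 :=
  (h.section_snd_eq_zero hL).self_of_nhdsWithin hq

/-- The other half of the bracket differentiates the (1,0) part of `conjField L'`, which vanishes on
`M`, in a direction tangent to `M`. -/
lemma bracket_fst (h : IsDefining M r R q) (hq : q ∈ M) {L L' : C3 → CVec}
    (hL : IsLocalSection M (T10 M) q L) (hL' : IsLocalSection M (T10 M) q L') :
    (bracket L (conjField L') q).1 =
      -complexify (fderiv ℝ (fun x => (L x).1) q) (0, star (L' q).1) := by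
  obtain ⟨e1, e2⟩ := h.section_apply hq hL
  obtain ⟨e1', e2'⟩ := h.section_apply hq hL'
  have hc : conjField L' q = (0, star (L' q).1) := by simp [conjField, conjVec, e1']
  have hLq : L q = ((L q).1, 0) := Prod.ext rfl e1
  have hf := fun Z => map_complexify_fderiv (ContinuousLinearMap.fst ℂ C3 C3)
    hL.1.differentiableAt (q := q) Z
  have hf' := fun Z => map_complexify_fderiv (ContinuousLinearMap.fst ℂ C3 C3)
    (analyticAt_conjField hL'.1).differentiableAt (q := q) Z
  simp only [ContinuousLinearMap.coe_fst'] at hf hf'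
  rw [bracket, Prod.fst_sub, hf, hf', hc]
  have h0 : complexify (fderiv ℝ (fun x => (conjField L' x).1) q) (L q) = 0 := by
    refine h.complexify_fderiv_eq_zero hq
      (analyticAt_fst_comp (analyticAt_conjField hL'.1)).differentiableAt ?_ (by rwa [hLq])
    filter_upwards [h.section_snd_eq_zero hL'] with x hx
    simp [conjField, conjVec, hx.1]
  rw [h0, zero_sub]

lemma bracket_snd (h : IsDefining M r R q) (hq : q ∈ M) {L L' : C3 → CVec}
    (hL : IsLocalSection M (T10 M) q L) (hL' : IsLocalSection M (T10 M) q L') :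
    (bracket L (conjField L') q).2 =
      complexify (fderiv ℝ (fun x => star (L' x).1) q) ((L q).1, 0) := by
  obtain ⟨e1, e2⟩ := h.section_apply hq hL
  obtain ⟨e1', e2'⟩ := h.section_apply hq hL'
  have hc : conjField L' q = (0, star (L' q).1) := by simp [conjField, conjVec, e1']
  have hLq : L q = ((L q).1, 0) := Prod.ext rfl e1
  have hf := fun Z => map_complexify_fderiv (ContinuousLinearMap.snd ℂ C3 C3)
    hL.1.differentiableAt (q := q) Z
  have hf' := fun Z => map_complexify_fderiv (ContinuousLinearMap.snd ℂ C3 C3)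
    (analyticAt_conjField hL'.1).differentiableAt (q := q) Z
  simp only [ContinuousLinearMap.coe_snd'] at hf hf'
  rw [bracket, Prod.snd_sub, hf, hf', hc]
  have h0 : complexify (fderiv ℝ (fun x => (L x).2) q) (0, star (L' q).1) = 0 := by
    refine h.complexify_fderiv_eq_zero hq (analyticAt_snd_comp hL.1).differentiableAt ?_ ?_
    · exact (h.section_snd_eq_zero hL).mono fun x hx => hx.1
    · rw [h.fderiv_inr_star, e2', star_zero]
  rw [h0, sub_zero, hLq]
  rfl

/-- `hess_add_eq_zero` trades the derivative of `L` along the conjugate of `L'` for the Hessian of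
`R`; in this way the Levi form depends only on the values of the two sections at `q`. -/
lemma fderiv_bracket_fst (h : IsDefining M r R q) (hq : q ∈ M) {L L' : C3 → CVec}
    (hL : IsLocalSection M (T10 M) q L) (hL' : IsLocalSection M (T10 M) q L') :
    fderiv ℂ R (realVec q) ((bracket L (conjField L') q).1, 0) =
      hess R q (0, star (L' q).1) ((L q).1, 0) := by
  have h1 := h.hess_add_eq_zero hq (ContinuousLinearMap.inl ℂ C3 C3)
    (analyticAt_fst_comp hL.1).differentiableAt
    ((h.section_snd_eq_zero hL).mono fun x hx => hx.2) (Z := (0, star (L' q).1))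
    (by rw [h.fderiv_inr_star, (h.section_apply hq hL').2, star_zero])
  simp only [ContinuousLinearMap.inl_apply] at h1
  rw [h.bracket_fst hq hL hL']
  have : ∀ a : C3, ((-a, 0) : CVec) = -(a, 0) := fun a => by simp
  rw [this, map_neg]
  linear_combination -h1

lemma fderiv_bracket_snd (h : IsDefining M r R q) (hq : q ∈ M) {L L' : C3 → CVec}
    (hL : IsLocalSection M (T10 M) q L) (hL' : IsLocalSection M (T10 M) q L') :
    fderiv ℂ R (realVec q) (0, (bracket L (conjField L') q).2) =
      -hess R q (0, star (L' q).1) ((L q).1, 0) := by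
  have h1 := h.hess_add_eq_zero hq (ContinuousLinearMap.inr ℂ C3 C3)
    (analyticAt_star (analyticAt_fst_comp hL'.1)).differentiableAt
    (by
      filter_upwards [h.section_snd_eq_zero hL', nhdsWithin_le_nhds h.eventually] with x hx h2
      rw [ContinuousLinearMap.inr_apply, h2.fderiv_inr_star, hx.2, star_zero])
    (Z := ((L q).1, 0)) (h.section_apply hq hL).2
  simp only [ContinuousLinearMap.inr_apply] at h1
  rw [h.bracket_snd hq hL hL', h.hess_symm]
  linear_combination h1

lemma bracket_mem_complexTangentSpace (h : IsDefining M r R q) (hq : q ∈ M) {L L' : C3 → CVec}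
    (hL : IsLocalSection M (T10 M) q L) (hL' : IsLocalSection M (T10 M) q L') :
    bracket L (conjField L') q ∈ complexTangentSpace M q := by
  refine h.mem_complexTangentSpace hq ?_
  have : bracket L (conjField L') q = ((bracket L (conjField L') q).1, 0) +
      (0, (bracket L (conjField L') q).2) := by simp
  rw [this, map_add, h.fderiv_bracket_fst hq hL hL', h.fderiv_bracket_snd hq hL hL']
  simp

lemma bracket_mem_iff (h : IsDefining M r R q) (hq : q ∈ M) {L L' : C3 → CVec}
    (hL : IsLocalSection M (T10 M) q L) (hL' : IsLocalSection M (T10 M) q L') :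
    bracket L (conjField L') q ∈ T10 M q ⊔ T01 M q ↔
      hess R q (0, star (L' q).1) ((L q).1, 0) = 0 := by
  rw [h.mem_T10_sup_T01_iff hq, h.fderiv_bracket_fst hq hL hL', h.fderiv_bracket_snd hq hL hL']
  simp

lemma analyticAt_fderiv_inl (h : IsDefining M r R q) (a : C3) :
    AnalyticAt ℝ (fun x => fderiv ℂ R (realVec x) (a, 0)) q := by
  have h1 : AnalyticAt ℂ (fun Z => fderiv ℂ R Z (a, 0)) (realVec q) :=
    ((ContinuousLinearMap.apply ℂ ℂ ((a, 0) : CVec)).analyticAt _).comp h.analyticAt.fderiv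
  exact analyticAt_comp_realVec h1

/-- Every vector of `T^{1,0}_q M` extends to a local section of `T^{1,0} M`. -/
lemma exists_section (h : IsDefining M r R q) {a : C3}
    (ha : fderiv ℂ R (realVec q) (a, 0) = 0) :
    ∃ L, IsLocalSection M (T10 M) q L ∧ L q = (a, 0) := by
  obtain ⟨v, hv⟩ := h.exists_fderiv_inl_eq_one
  -- The constant field `a` is corrected along a transverse vector `v` so as to stay in the kernel
  -- of dR(·, 0).
  let c : C3 → ℂ := fun x => fderiv ℂ R (realVec x) (a, 0) / fderiv ℂ R (realVec x) (v, 0)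
  have hne : fderiv ℂ R (realVec q) (v, 0) ≠ 0 := by rw [hv]; exact one_ne_zero
  have hc : AnalyticAt ℝ c q := (h.analyticAt_fderiv_inl a).div (h.analyticAt_fderiv_inl v) hne
  refine ⟨fun x => (a - c x • v, 0), ⟨?_, ?_⟩, ?_⟩
  · exact (analyticAt_const.sub (hc.smul analyticAt_const)).prod analyticAt_const
  · have hev : ∀ᶠ x in 𝓝 q, fderiv ℂ R (realVec x) (v, 0) ≠ 0 :=
      (h.analyticAt_fderiv_inl v).continuousAt.eventually_ne hne
    filter_upwards [nhdsWithin_le_nhds h.eventually, nhdsWithin_le_nhds hev, self_mem_nhdsWithin]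
      with x h1 h2 h3
    rw [h1.mem_T10_iff h3]
    refine ⟨rfl, ?_⟩
    have : ((a - c x • v, 0) : CVec) = (a, 0) - c x • (v, 0) := by simp
    show fderiv ℂ R (realVec x) (a - c x • v, 0) = 0
    rw [this, map_sub, map_smul, smul_eq_mul, div_mul_cancel₀ _ h2, sub_self]
  · simp [c, ha]

/-- `bracket_mem_iff` makes the condition on sections pointwise, and `exists_section` realizes every
admissible `b` as the conjugate of a section value. -/
lemma mem_K10_iff (h : IsDefining M r R q) (hq : q ∈ M) {Z : CVec} :
    Z ∈ K10 M q ↔ Z.2 = 0 ∧ fderiv ℂ R (realVec q) (Z.1, 0) = 0 ∧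
      ∀ b, fderiv ℂ R (realVec q) (0, b) = 0 → hess R q (0, b) (Z.1, 0) = 0 := by
  constructor
  · rintro ⟨hT, L, hL, rfl, hLL⟩
    obtain ⟨e1, e2⟩ := (h.mem_T10_iff hq).1 hT
    refine ⟨e1, e2, fun b hb => ?_⟩
    obtain ⟨L', hL', hLq⟩ := h.exists_section ((h.fderiv_inr_eq_zero_iff b).1 hb)
    have := (h.bracket_mem_iff hq hL hL').1 (hLL L' hL')
    rwa [hLq, star_star] at this
  · rintro ⟨e1, e2, e3⟩
    obtain ⟨L, hL, hLq⟩ := h.exists_section e2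
    have hZ : L q = Z := hLq.trans (Prod.ext rfl e1.symm)
    refine ⟨(h.mem_T10_iff hq).2 ⟨e1, e2⟩, L, hL, hZ, fun L' hL' => ?_⟩
    rw [h.bracket_mem_iff hq hL hL', hZ]
    exact e3 _ (by rw [h.fderiv_inr_star, (h.section_apply hq hL').2, star_zero])

end IsDefining

/-! ### The Levi matrix and its rank -/

lemma evalForm_add (ρ : C3 →L[ℝ] ℝ) (Z W : CVec) :
    evalForm ρ (Z + W) = evalForm ρ Z + evalForm ρ W := complexify_add _ Z W

lemma evalForm_smul (ρ : C3 →L[ℝ] ℝ) (c : ℂ) (Z : CVec) :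
    evalForm ρ (c • Z) = c * evalForm ρ Z := complexify_smul _ c Z

namespace IsDefining

variable {M : Set C3} {r : C3 → ℝ} {R : CVec → ℂ} {q : C3}

/-- Row `j` tests the Hessian against the conjugate of `L j`: on brackets, vanishing of `ρ` means
lying in T10 ⊕ T01, so `ρ` drops out, and the conjugates of the frame span all of the `b` that
matter. -/
lemma leviMatrix_mulVec_eq_zero_iff (h : IsDefining M r R q) (hq : q ∈ M)
    {ρ : C3 → C3 →L[ℝ] ℝ} {L : Fin 2 → C3 → CVec} (hρ : IsCharacteristicForm M q ρ)
    (hL : IsLocalT10Frame M q L) (c : Fin 2 → ℂ) :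
    (leviMatrix ρ L q).mulVec c = 0 ↔ c 0 • L 0 q + c 1 • L 1 q ∈ K10 M q := by
  have hρq := hρ.2.self_of_nhdsWithin hq
  have hspan := (hL.2.self_of_nhdsWithin hq).2
  have hLq := fun i => h.section_apply hq (hL.1 i)
  have hkey : ∀ j, (leviMatrix ρ L q).mulVec c j = 0 ↔
      hess R q (0, star (L j q).1) ((c 0 • L 0 q + c 1 • L 1 q).1, 0) = 0 := by
    intro j
    let X : Fin 2 → CVec := fun k => bracket (L k) (conjField (L j)) q
    have e : (leviMatrix ρ L q).mulVec c j =
        Complex.I * evalForm (ρ q) (c 0 • X 0 + c 1 • X 1) := by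
      simp only [Matrix.mulVec, dotProduct, Fin.sum_univ_two, leviMatrix, Matrix.of_apply,
        evalForm_add, evalForm_smul, X]
      ring
    have hX : ∀ k, X k ∈ complexTangentSpace M q := fun k =>
      h.bracket_mem_complexTangentSpace hq (hL.1 k) (hL.1 j)
    have hmem : c 0 • X 0 + c 1 • X 1 ∈ complexTangentSpace M q :=
      add_mem (Submodule.smul_mem _ _ (hX 0)) (Submodule.smul_mem _ _ (hX 1))
    have h1 : ∀ k, fderiv ℂ R (realVec q) ((X k).1, 0) =
        hess R q (0, star (L j q).1) ((L k q).1, 0) := fun k =>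
      h.fderiv_bracket_fst hq (hL.1 k) (hL.1 j)
    have h2 : ∀ k, fderiv ℂ R (realVec q) (0, (X k).2) =
        -hess R q (0, star (L j q).1) ((L k q).1, 0) := fun k =>
      h.fderiv_bracket_snd hq (hL.1 k) (hL.1 j)
    have a1 : (((c 0 • X 0 + c 1 • X 1).1, 0) : CVec) =
      c 0 • ((X 0).1, 0) + c 1 • ((X 1).1, 0) := by simp
    have a2 : ((0, (c 0 • X 0 + c 1 • X 1).2) : CVec) =
      c 0 • (0, (X 0).2) + c 1 • (0, (X 1).2) := by simp
    have a3 : (((c 0 • L 0 q + c 1 • L 1 q).1, 0) : CVec) =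
      c 0 • ((L 0 q).1, 0) + c 1 • ((L 1 q).1, 0) := by simp
    rw [e, mul_eq_zero_iff_left Complex.I_ne_zero, hρq _ hmem, h.mem_T10_sup_T01_iff hq, a1, a2, a3,
      map_add, map_add, map_add, map_smul, map_smul, map_smul, map_smul, map_smul, map_smul,
      h1, h1, h2, h2]
    simp only [smul_eq_mul]
    constructor
    · exact fun hh => hh.1
    · intro hh
      exact ⟨hh, by linear_combination -hh⟩
  rw [h.mem_K10_iff hq]
  constructor
  · intro hc
    refine ⟨by simp [(hLq 0).1, (hLq 1).1], ?_, fun b hb => ?_⟩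
    · have a3 : (((c 0 • L 0 q + c 1 • L 1 q).1, 0) : CVec) =
        c 0 • ((L 0 q).1, 0) + c 1 • ((L 1 q).1, 0) := by simp
      rw [a3, map_add, map_smul, map_smul, (hLq 0).2, (hLq 1).2]
      simp
    · have hb' : ((star b, 0) : CVec) ∈ T10 M q :=
        (h.mem_T10_iff hq).2 ⟨rfl, (h.fderiv_inr_eq_zero_iff b).1 hb⟩
      rw [← hspan, Submodule.mem_span_range_iff_exists_fun] at hb'
      obtain ⟨d, hd⟩ := hb'
      rw [Fin.sum_univ_two] at hd
      have hd1 : d 0 • (L 0 q).1 + d 1 • (L 1 q).1 = star b := congrArg Prod.fst hd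
      have hb2 : ((0, b) : CVec) =
          star (d 0) • (0, star (L 0 q).1) + star (d 1) • (0, star (L 1 q).1) := by
        rw [← star_star b, ← hd1]
        simp
      rw [hb2, map_add, map_smul, map_smul, add_apply, smul_apply, smul_apply,
        (hkey 0).1 (congrFun hc 0), (hkey 1).1 (congrFun hc 1)]
      simp
  · rintro ⟨-, -, h3⟩
    ext j
    refine (hkey j).2 (h3 _ ?_)
    rw [h.fderiv_inr_star, (hLq j).2, star_zero]

/-- If the Levi form has rank `1`, its kernel is a line and it is not zero. -/
lemma exists_generator_K10 (h : IsDefining M r R q) (hq : q ∈ M) (hLevi : HasLeviRank M q 1) :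
    ∃ k : C3, k ≠ 0 ∧ (k, 0) ∈ K10 M q ∧ (∀ Z ∈ K10 M q, ∃ c : ℂ, Z = (c • k, 0)) ∧
      ∃ a b : C3, fderiv ℂ R (realVec q) (a, 0) = 0 ∧ fderiv ℂ R (realVec q) (0, b) = 0 ∧
        hess R q (0, b) (a, 0) ≠ 0 := by
  obtain ⟨ρ, L, hρ, hL, hrank⟩ := hLevi
  have hkey := h.leviMatrix_mulVec_eq_zero_iff hq hρ hL
  obtain ⟨hli, hspan⟩ := hL.2.self_of_nhdsWithin hq
  have hLq := fun i => h.section_apply hq (hL.1 i)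
  set m := leviMatrix ρ L q with hm
  -- Rank-nullity on ℂ²: rank one leaves a one-dimensional kernel.
  have hker : Module.finrank ℂ (LinearMap.ker m.mulVecLin) = 1 := by
    have h1 := LinearMap.finrank_range_add_finrank_ker m.mulVecLin
    have h2 : Module.finrank ℂ (LinearMap.range m.mulVecLin) = 1 := hrank
    rw [h2] at h1
    simp at h1
    omega
  obtain ⟨v, hv, hvc⟩ := finrank_eq_one_iff'.1 hker
  have hvK : v.1 0 • L 0 q + v.1 1 • L 1 q ∈ K10 M q := (hkey v.1).1 v.2
  have hsnd : ∀ c : Fin 2 → ℂ, c 0 • L 0 q + c 1 • L 1 q =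
      ((c 0 • L 0 q + c 1 • L 1 q).1, 0) := fun c =>
    Prod.ext rfl (by simp [(hLq 0).1, (hLq 1).1])
  refine ⟨(v.1 0 • L 0 q + v.1 1 • L 1 q).1, ?_, ?_, ?_, ?_⟩
  · intro h0
    have h1 : v.1 0 • L 0 q + v.1 1 • L 1 q = 0 := by rw [hsnd, h0]; rfl
    have h2 := Fintype.linearIndependent_iff.1 hli v.1 (by rwa [Fin.sum_univ_two])
    exact hv (Subtype.ext (funext h2))
  · rw [← hsnd]
    exact hvK
  · intro Z hZ
    have hZT : Z ∈ T10 M q := hZ.1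
    rw [← hspan, Submodule.mem_span_range_iff_exists_fun] at hZT
    obtain ⟨d, hd⟩ := hZT
    rw [Fin.sum_univ_two] at hd
    obtain ⟨c, hc⟩ := hvc ⟨d, (hkey d).2 (by rwa [hd])⟩
    have hc' : ∀ i, c * v.1 i = d i := fun i => congrFun (congrArg Subtype.val hc) i
    refine ⟨c, ?_⟩
    have : ((c • (v.1 0 • L 0 q + v.1 1 • L 1 q).1, 0) : CVec) =
        c • ((v.1 0 • L 0 q + v.1 1 • L 1 q).1, 0) := by simp
    rw [this, ← hsnd, ← hd, smul_add, smul_smul, smul_smul, hc', hc']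
  -- If the Hessian vanished on all tangent pairs, the kernel of the Levi matrix would have
  -- dimension 2.
  · by_contra! hc
    have hall : ∀ c, m.mulVec c = 0 := by
      intro c
      rw [hkey, h.mem_K10_iff hq]
      have hT : c 0 • L 0 q + c 1 • L 1 q ∈ T10 M q :=
        add_mem (Submodule.smul_mem _ _ ((h.mem_T10_iff hq).2 (hLq 0)))
          (Submodule.smul_mem _ _ ((h.mem_T10_iff hq).2 (hLq 1)))
      obtain ⟨t1, t2⟩ := (h.mem_T10_iff hq).1 hT
      exact ⟨t1, t2, fun b hb => hc _ _ t2 hb⟩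
    have htop : LinearMap.ker m.mulVecLin = ⊤ := by
      ext c
      simpa using hall c
    rw [htop, finrank_top] at hker
    simp at hker

end IsDefining

/-! ### Holomorphy of directional derivatives, by Cauchy's formula -/

section DirectionalDerivative

variable {E G : Type*} [NormedAddCommGroup E] [NormedSpace ℂ E] [FiniteDimensional ℂ E]
  [NormedAddCommGroup G] [NormedSpace ℂ G] [FiniteDimensional ℂ G]

/-- The directional derivatives of a holomorphic map are holomorphic. -/
theorem differentiableAt_fderiv_apply {g : E → G} {U : Set E} (hU : IsOpen U)
    (hg : DifferentiableOn ℂ g U) {x₀ : E} (hx₀ : x₀ ∈ U) (v : E) :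
    DifferentiableAt ℂ (fun x => fderiv ℂ g x v) x₀ := by
  have : CompleteSpace G := FiniteDimensional.complete ℂ G
  have hcont : ContinuousAt g x₀ := (hg.differentiableAt (hU.mem_nhds hx₀)).continuousAt
  obtain ⟨ε, hε, hεU⟩ : ∃ ε > 0, ∀ x ∈ Metric.ball x₀ ε, x ∈ U ∧ dist (g x) (g x₀) < 1 := by
    have := Filter.Eventually.and (hU.mem_nhds hx₀)
      (hcont.eventually (Metric.ball_mem_nhds (g x₀) one_pos))
    exact Metric.eventually_nhds_iff_ball.1 this
  have hdiff : ∀ x ∈ Metric.ball x₀ ε, DifferentiableAt ℂ g x := fun x hx =>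
    hg.differentiableAt (hU.mem_nhds (hεU x hx).1)
  have hbound : ∀ y ∈ Metric.ball x₀ (ε / 2), ‖fderiv ℂ g y‖ ≤ 2 / (ε / 2) := by
    intro y hy
    have hsub : Metric.ball y (ε / 2) ⊆ Metric.ball x₀ ε := by
      refine Metric.ball_subset_ball' ?_
      rw [Metric.mem_ball] at hy
      linarith
    refine Complex.norm_fderiv_le_div_of_mapsTo_ball
      (fun x hx => (hdiff x (hsub hx)).differentiableWithinAt) ?_ (by positivity)
    intro x hx
    rw [Metric.mem_closedBall]
    have h1 := (hεU x (hsub hx)).2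
    have h2 := (hεU y (hsub (Metric.mem_ball_self (by positivity)))).2
    have := dist_triangle_right (g x) (g y) (g x₀)
    linarith
  -- With this `δ`, circles of radius `δ` in the direction `v` centred in the ball of radius ε/4
  -- stay in the ball of radius ε/2, where the Cauchy estimate `hbound` holds.
  obtain ⟨δ, hδ, hδv⟩ : ∃ δ > 0, δ * ‖v‖ < ε / 4 := by
    refine ⟨ε / 8 / (‖v‖ + 1), by positivity, ?_⟩
    rw [div_mul_eq_mul_div, div_lt_iff₀ (by positivity)]
    nlinarith [norm_nonneg v]
  have hshift : ∀ x ∈ Metric.ball x₀ (ε / 4), ∀ c : ℂ, ‖c‖ ≤ δ →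
      x + c • v ∈ Metric.ball x₀ (ε / 2) := by
    intro x hx c hc
    rw [Metric.mem_ball, dist_eq_norm] at hx ⊢
    have h1 : ‖c • v‖ ≤ δ * ‖v‖ := by rw [norm_smul]; gcongr
    have h2 : x + c • v - x₀ = (x - x₀) + c • v := by abel
    rw [h2]
    linarith [norm_add_le (x - x₀) (c • v)]
  have hhalf : Metric.ball x₀ (ε / 2) ⊆ Metric.ball x₀ ε := Metric.ball_subset_ball (by linarith)
  let γ : ℝ → ℂ := circleMap 0 δ
  have hγ : ∀ θ, ‖γ θ‖ = δ := fun θ => by simp [γ, abs_of_pos hδ]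
  have hγ0 : ∀ θ, γ θ ≠ 0 := fun θ h0 => by
    have := hγ θ
    rw [h0, norm_zero] at this
    exact hδ.ne this
  have hγc : Continuous γ := continuous_circleMap 0 δ
  let w : ℝ → ℂ := fun θ => (γ θ * Complex.I) * (1 / γ θ ^ 2)
  have hw : Continuous w := (hγc.mul continuous_const).mul
    (continuous_const.div (hγc.pow 2) fun θ => pow_ne_zero 2 (hγ0 θ))
  have hline : ∀ x : E, ∀ c : ℂ, HasDerivAt (fun z : ℂ => x + z • v) v c := fun x c => by
    simpa using ((hasDerivAt_id c).smul_const v).const_add x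
  -- Cauchy's formula for the derivative on the complex line x + ℂ v. It involves only values of
  -- `g`, so it can be differentiated in `x` under the integral, with `hbound` giving domination.
  have hformula : ∀ x ∈ Metric.ball x₀ (ε / 4), fderiv ℂ g x v =
      (2 * Real.pi * Complex.I)⁻¹ • ∫ θ in (0)..2 * Real.pi, w θ • g (x + γ θ • v) := by
    intro x hx
    have hd : ∀ c : ℂ, ‖c‖ ≤ δ → HasDerivAt (fun z : ℂ => g (x + z • v))
        (fderiv ℂ g (x + c • v) v) c := fun c hc =>
      (hdiff _ (hhalf (hshift x hx c hc))).hasFDerivAt.comp_hasDerivAt c (hline x c)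
    have hdc : DiffContOnCl ℂ (fun z : ℂ => g (x + z • v)) (Metric.ball 0 δ) := by
      refine DifferentiableOn.diffContOnCl fun c hc => ?_
      rw [closure_ball _ hδ.ne', mem_closedBall_zero_iff] at hc
      exact (hd c hc).differentiableAt.differentiableWithinAt
    have h1 := hdc.circleIntegral_one_div_sub_center_pow_smul hδ 1
    have h2 : deriv (fun z : ℂ => g (x + z • v)) 0 = fderiv ℂ g x v := by
      have := (hd 0 (by simpa using hδ.le)).deriv
      simpa using this
    rw [iteratedDeriv_one, h2, circleIntegral] at h1
    simp only [Nat.factorial_one, Nat.cast_one, div_one, sub_zero, deriv_circleMap,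
      smul_smul] at h1
    have h3 : (∫ θ in (0)..2 * Real.pi, w θ • g (x + γ θ • v)) =
        (2 * Real.pi * Complex.I : ℂ) • fderiv ℂ g x v := h1
    rw [h3, inv_smul_smul₀]
    simp [Real.pi_ne_zero]
  let F : E → ℝ → G := fun x θ => w θ • g (x + γ θ • v)
  let F' : E → ℝ → E →L[ℂ] G := fun x θ => w θ • fderiv ℂ g (x + γ θ • v)
  have hFc : ∀ x ∈ Metric.ball x₀ (ε / 4), Continuous (F x) := by
    intro x hx
    refine hw.smul (continuous_iff_continuousAt.2 fun θ => ?_)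
    exact ContinuousAt.comp (f := fun θ => x + γ θ • v)
      (hdiff _ (hhalf (hshift x hx _ (hγ θ).le))).continuousAt
      (by fun_prop)
  have hball : Metric.ball x₀ (ε / 4) ∈ 𝓝 x₀ := Metric.ball_mem_nhds _ (by positivity)
  have hint : HasFDerivAt (fun x => ∫ θ in (0)..2 * Real.pi, F x θ)
      (∫ θ in (0)..2 * Real.pi, F' x₀ θ) x₀ := by
    refine intervalIntegral.hasFDerivAt_integral_of_dominated_of_fderiv_le
      (bound := fun θ => ‖w θ‖ * (2 / (ε / 2))) hball ?_ ?_ ?_ ?_ ?_ ?_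
    · filter_upwards [hball] with x hx
      exact (hFc x hx).aestronglyMeasurable
    · exact (hFc x₀ (mem_of_mem_nhds hball)).intervalIntegrable _ _
    -- Measurability of the derivative suffices; its continuity is not presupposed.
    · borelize E
      have : FiniteDimensional ℂ (E →L[ℂ] G) := inferInstance
      have : ProperSpace (E →L[ℂ] G) := FiniteDimensional.proper ℂ _
      have hm : Measurable fun θ : ℝ => fderiv ℂ g (x₀ + γ θ • v) :=
        (measurable_fderiv ℂ g).comp (by fun_prop : Continuous fun θ : ℝ => x₀ + γ θ • v).measurable
      exact hw.aestronglyMeasurable.smul hm.aestronglyMeasurable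
    · refine .of_forall fun θ _ x hx => ?_
      rw [norm_smul]
      gcongr
      exact hbound _ (hshift x hx _ (hγ θ).le)
    · exact (hw.norm.mul continuous_const).intervalIntegrable _ _
    · refine .of_forall fun θ _ x hx => ?_
      refine HasFDerivAt.const_smul ?_ (w θ)
      have h1 := (hdiff _ (hhalf (hshift x hx _ (hγ θ).le))).hasFDerivAt.comp x
        ((hasFDerivAt_id x).add_const (γ θ • v))
      exact h1
  refine (hint.const_smul (2 * Real.pi * Complex.I : ℂ)⁻¹).differentiableAt.congr_of_eventuallyEq ?_
  filter_upwards [hball] with x hx using hformula x hx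

end DirectionalDerivative

/-! ### A product has vanishing Freeman form -/

lemma complexify_fderiv_of_differentiableAt {F : Type*} [NormedAddCommGroup F] [NormedSpace ℂ F]
    {f : C3 → F} {q : C3} (hf : DifferentiableAt ℂ f q) (b : C3) :
    complexify (fderiv ℝ f q) (0, b) = 0 := by
  rw [(hf.hasFDerivAt.restrictScalars ℝ).fderiv]
  simp [complexify, smul_smul]

lemma complexify_fderiv_smul {f : C3 → ℂ} {g : C3 → C3} {q : C3} (hf : DifferentiableAt ℝ f q)
    (hg : DifferentiableAt ℝ g q) (Z : CVec) :
    complexify (fderiv ℝ (fun x => f x • g x) q) Z =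
      f q • complexify (fderiv ℝ g q) Z + complexify (fderiv ℝ f q) Z • g q := by
  have h := (hf.hasFDerivAt.smul hg.hasFDerivAt).fderiv
  rw [complexify_eq_of_realVec _ (f q • complexifyL C3 (fderiv ℝ g q) +
    (complexifyL ℂ (fderiv ℝ f q)).smulRight (g q))]
  · rfl
  · intro x
    simp only [add_apply, smul_apply, ContinuousLinearMap.smulRight_apply, complexifyL_apply,
      complexify_realVec]
    rw [show fderiv ℝ (fun x => f x • g x) q = _ from h]
    rfl

/-- The Freeman form vanishes at `p` if there is, near `p`, a holomorphic field that generates the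
kernel of the Levi form along `M`. -/
lemma IsDefining.freemanFormVanishesAt {M : Set C3} {r : C3 → ℝ} {R : CVec → ℂ} {p : C3}
    (h : IsDefining M r R p) (hp : p ∈ M) (hLevi : ∀ q ∈ M, HasLeviRank M q 1) {k : C3 → C3}
    (hk : DifferentiableAt ℂ k p) (hk0 : k p ≠ 0)
    (hkK : ∀ᶠ x in 𝓝[M] p, (k x, 0) ∈ K10 M x) : FreemanFormVanishesAt M p := by
  intro K L hK hL
  have hKT : IsLocalSection M (T10 M) p K := ⟨hK.1, hK.2.mono fun x hx => hx.1⟩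
  have hKp := hK.2.self_of_nhdsWithin hp
  obtain ⟨ξ, hξ⟩ : ∃ ξ : C3 →L[ℂ] ℂ, ξ (k p) ≠ 0 := by
    obtain ⟨i, hi⟩ := Function.ne_iff.1 hk0
    exact ⟨ContinuousLinearMap.proj i, hi⟩
  let κ : C3 → C3 := fun x => (K x).1
  have hκ : DifferentiableAt ℝ κ p := (analyticAt_fst_comp hK.1).differentiableAt
  have hkR : DifferentiableAt ℝ k p := hk.restrictScalars ℝ
  have hξR : ∀ {g : C3 → C3}, DifferentiableAt ℝ g p → DifferentiableAt ℝ (fun x => ξ (g x)) p :=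
    fun hg => (ξ.restrictScalars ℝ).differentiableAt.comp p hg
  -- Along `M` both `K` and `k` lie in the same kernel line, and `ξ` reads off their ratio.
  let f : C3 → ℂ := fun x => ξ (κ x) * (ξ (k x))⁻¹
  have hf : DifferentiableAt ℝ f p := (hξR hκ).mul ((hξR hkR).inv hξ)
  have hne : ∀ᶠ x in 𝓝 p, ξ (k x) ≠ 0 := (hξR hkR).continuousAt.eventually_ne hξ
  have hD : ∀ᶠ x in 𝓝[M] p, κ x - f x • k x = 0 := by
    filter_upwards [nhdsWithin_le_nhds hne, nhdsWithin_le_nhds h.eventually, self_mem_nhdsWithin,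
      hkK, hK.2] with x h1 h2 h3 h4 h5
    obtain ⟨g, -, -, hg, -⟩ := h2.exists_generator_K10 h3 (hLevi x h3)
    obtain ⟨c, hc⟩ := hg _ h4
    obtain ⟨d, hd⟩ := hg _ h5
    have e1 : k x = c • g := congrArg Prod.fst hc
    have e2 : κ x = d • g := congrArg Prod.fst hd
    rw [e1, map_smul, smul_eq_mul] at h1
    have hc0 := left_ne_zero_of_mul h1
    have hg0 := right_ne_zero_of_mul h1
    simp only [f]
    rw [e1, e2, map_smul, map_smul, smul_smul, sub_eq_zero]
    congr 1
    simp only [smul_eq_mul]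
    field_simp
  let b := star (L p).1
  have hb : fderiv ℂ R (realVec p) (0, b) = 0 := by
    rw [h.fderiv_inr_star, (h.section_apply hp hL).2, star_zero]
  have h0 := h.complexify_fderiv_eq_zero hp (hκ.sub (hf.smul hkR)) hD hb
  have hsub : complexify (fderiv ℝ (fun x => κ x - f x • k x) p) (0, b) =
      complexify (fderiv ℝ κ p) (0, b) -
        complexify (fderiv ℝ (fun x => f x • k x) p) (0, b) := by
    have := fderiv_sub hκ (hf.smul hkR)
    rw [show fderiv ℝ (fun x => κ x - f x • k x) p = _ from this, ← complexifyL_apply, map_sub]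
    rfl
  have h0' : complexify (fderiv ℝ (fun x => κ x - f x • k x) p) (0, b) = 0 := h0
  rw [hsub, complexify_fderiv_smul hf hkR, complexify_fderiv_of_differentiableAt hk, smul_zero,
    zero_add, sub_eq_zero] at h0'
  have e1 : (bracket K (conjField L) p).1 = -complexify (fderiv ℝ κ p) (0, b) :=
    h.bracket_fst hp hKT hL
  have e2 : fderiv ℂ R (realVec p) (0, (bracket K (conjField L) p).2) = 0 := by
    rw [h.fderiv_bracket_snd hp hKT hL, ((h.mem_K10_iff hp).1 hKp).2.2 b hb, neg_zero]
  rw [freemanForm, Submodule.Quotient.mk_eq_zero]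
  -- As `k` is holomorphic, only the factor `f` is differentiated, so the (1,0) part of the bracket
  -- is a multiple of `k`. The (0,1) part is tangent because `K` is in the Levi kernel.
  have hsplit : bracket K (conjField L) p =
      (-complexify (fderiv ℝ f p) (0, b)) • (k p, 0) + (0, (bracket K (conjField L) p).2) := by
    refine Prod.ext ?_ (by simp)
    rw [e1, h0']
    simp
  rw [hsplit]
  exact Submodule.add_mem_sup
    (Submodule.smul_mem _ _ (hkK.self_of_nhdsWithin hp)) ((h.mem_T01_iff hp).2 ⟨rfl, e2⟩)

/-- In `hess_add_eq_zero` the term with the ∂̄-derivative of `k` disappears, leaving only the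
Hessian. -/
lemma IsDefining.mem_K10_of_holomorphic {M : Set C3} {r : C3 → ℝ} {R : CVec → ℂ} {p : C3}
    (h : IsDefining M r R p) (hp : p ∈ M) {k : C3 → C3} (hk : DifferentiableAt ℂ k p)
    (hkT : ∀ᶠ x in 𝓝[M] p, fderiv ℂ R (realVec x) (k x, 0) = 0) : (k p, 0) ∈ K10 M p := by
  rw [h.mem_K10_iff hp]
  refine ⟨rfl, hkT.self_of_nhdsWithin hp, fun b hb => ?_⟩
  have h1 := h.hess_add_eq_zero hp (ContinuousLinearMap.inl ℂ C3 C3) (hk.restrictScalars ℝ) hkT hb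
  rwa [complexify_fderiv_of_differentiableAt hk, map_zero, map_zero, add_zero] at h1

/-- The field `k`, image of the last coordinate direction under the inverse chart, is holomorphic,
nonzero and tangent to `M`, so it spans the Levi kernel. -/
theorem freemanFormVanishesAt_of_product {M : Set C3} (hM : IsRealAnalyticHypersurface M)
    (hLevi : ∀ q ∈ M, HasLeviRank M q 1) (hprod : IsLocallyBiholomorphicToProduct M) {p : C3}
    (hp : p ∈ M) : FreemanFormVanishesAt M p := by
  obtain ⟨M', -, h, hps, hd, hds, himg⟩ := hprod p hp
  obtain ⟨r, R, hdef⟩ := hM.exists_isDefining hp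
  let k : C3 → C3 := fun x => fderiv ℂ h.symm (h x) (0, 1)
  have hdx : ∀ x ∈ h.source, DifferentiableAt ℂ h x := fun x hx =>
    hd.differentiableAt (h.open_source.mem_nhds hx)
  have hdsx : ∀ x ∈ h.source, DifferentiableAt ℂ h.symm (h x) := fun x hx =>
    hds.differentiableAt (h.open_target.mem_nhds (h.map_source hx))
  have hk : ∀ x ∈ h.source, DifferentiableAt ℂ k x := fun x hx =>
    (differentiableAt_fderiv_apply h.open_target hds (h.map_source hx) (0, 1)).comp x (hdx x hx)
  have hk0 : k p ≠ 0 := by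
    intro h0
    have h1 : HasFDerivAt (fun y => h (h.symm y))
        ((fderiv ℂ h p).comp (fderiv ℂ h.symm (h p))) (h p) := by
      refine HasFDerivAt.comp (h p) ?_ (hdsx p hps).hasFDerivAt
      rw [h.left_inv hps]
      exact (hdx p hps).hasFDerivAt
    have h2 : HasFDerivAt (fun y => h (h.symm y)) (ContinuousLinearMap.id ℂ _) (h p) := by
      refine (hasFDerivAt_id (h p)).congr_of_eventuallyEq ?_
      filter_upwards [h.open_target.mem_nhds (h.map_source hps)] with y hy using h.right_inv hy
    have h3 := congrArg (fun A => A ((0 : Fin 2 → ℂ), (1 : ℂ))) (h1.unique h2)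
    have h4 : fderiv ℂ h p (k p) = ((0 : Fin 2 → ℂ), (1 : ℂ)) := h3
    rw [h0, map_zero] at h4
    exact zero_ne_one (congrArg Prod.snd h4)
  have htan : ∀ x ∈ M, x ∈ h.source → IsDefining M r R x →
      fderiv ℂ R (realVec x) (k x, 0) = 0 := by
    intro x hxM hxs hx
    -- All complex multiples are needed: `c = 1` and `c = I` show that `k x` and its product with
    -- `i` are both tangent, so that (k, 0) has type (1,0).
    have key : ∀ c : ℂ, fderiv ℝ r x (c • k x) = 0 := by
      intro c
      let u : ℝ → (Fin 2 → ℂ) × ℂ := fun t => h x + t • ((0 : Fin 2 → ℂ), c)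
      have hu : HasDerivAt u ((0 : Fin 2 → ℂ), c) 0 := by
        have := ((hasDerivAt_id (0 : ℝ)).smul_const ((0 : Fin 2 → ℂ), c)).const_add (h x)
        rw [one_smul] at this
        exact this
      have hu0 : u 0 = h x := by simp [u]
      have hcu : HasDerivAt (fun t => h.symm (u t)) (c • k x) 0 := by
        have h1 : HasFDerivAt h.symm ((fderiv ℂ h.symm (h x)).restrictScalars ℝ) (u 0) := by
          rw [hu0]; exact (hdsx x hxs).hasFDerivAt.restrictScalars ℝ
        have h2 := h1.comp_hasDerivAt (0 : ℝ) hu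
        have e : c • k x = fderiv ℂ h.symm (h x) ((0 : Fin 2 → ℂ), c) := by
          simp only [k]
          rw [← map_smul]
          simp
        rw [e]
        exact h2
      have hc0 : h.symm (u 0) = x := by rw [hu0, h.left_inv hxs]
      have hmem : ∀ᶠ t in 𝓝 (0 : ℝ), h.symm (u t) ∈ M := by
        have h1 : ∀ᶠ t in 𝓝 (0 : ℝ), u t ∈ h.target := by
          refine hu.continuousAt.eventually ?_
          rw [hu0]
          exact h.open_target.mem_nhds (h.map_source hxs)
        have h2 : h x ∈ (M' ×ˢ (univ : Set ℂ)) ∩ h.target := by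
          rw [← himg]; exact ⟨x, ⟨hxM, hxs⟩, rfl⟩
        filter_upwards [h1] with t ht
        have h3 : u t ∈ (M' ×ˢ (univ : Set ℂ)) ∩ h.target := by
          refine ⟨⟨?_, mem_univ _⟩, ht⟩
          have : (u t).1 = (h x).1 := by simp [u]
          rw [this]
          exact h2.1.1
        rw [← himg] at h3
        obtain ⟨y, ⟨hyM, hys⟩, hy⟩ := h3
        rw [← hy, h.left_inv hys]
        exact hyM
      have hz : ∀ᶠ t in 𝓝 (0 : ℝ), r (h.symm (u t)) = 0 := by
        have hcont : Tendsto (fun t => h.symm (u t)) (𝓝 0) (𝓝 x) := by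
          have := hcu.continuousAt.tendsto
          rwa [hc0] at this
        filter_upwards [hcont.eventually hx.mem_iff, hmem] with t h1 h2 using h1.1 h2
      have hd1 : HasDerivAt (fun t => r (h.symm (u t))) (fderiv ℝ r x (c • k x)) 0 :=
        HasFDerivAt.comp_hasDerivAt (x := (0 : ℝ))
          (by rw [hc0]; exact hx.analyticAt_real.differentiableAt.hasFDerivAt) hcu
      exact hd1.unique ((hasDerivAt_const (0 : ℝ) (0 : ℝ)).congr_of_eventuallyEq hz)
    exact (hx.fderiv_inl_eq_zero_iff _).2 ⟨by simpa using key 1, key Complex.I⟩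
  refine hdef.freemanFormVanishesAt hp hLevi (hk p hps) hk0 ?_
  have hsrc : ∀ᶠ x in 𝓝 p, x ∈ h.source := h.open_source.mem_nhds hps
  filter_upwards [nhdsWithin_le_nhds hdef.eventually, nhdsWithin_le_nhds hsrc,
    self_mem_nhdsWithin] with x h1 h2 h3
  refine h1.mem_K10_of_holomorphic h3 (hk x h2) ?_
  filter_upwards [nhdsWithin_le_nhds h1.eventually,
    nhdsWithin_le_nhds (h.open_source.mem_nhds h2), self_mem_nhdsWithin] with y a1 a2 a3
  exact htan y a3 a2 a1

/-! ### Identity principle on the complexification {R = 0} -/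

lemma norm_le_of_eq_realVec_add {Z : CVec} {x y : C3}
    (h : Z = realVec x + Complex.I • realVec y) : ‖x‖ ≤ ‖Z‖ ∧ ‖y‖ ≤ ‖Z‖ := by
  have hI := Complex.I_mul_I
  have hx : x = (1 / 2 : ℂ) • (Z.1 + star Z.2) := by
    ext j
    simp [h, realVec]
    ring
  have hy : y = (-Complex.I / 2) • (Z.1 - star Z.2) := by
    ext j
    simp [h, realVec]
    linear_combination (y j) * hI
  have h1 : ‖Z.1‖ ≤ ‖Z‖ := norm_fst_le Z
  have h2 : ‖star Z.2‖ ≤ ‖Z‖ := by rw [norm_star]; exact norm_snd_le Z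
  constructor
  · rw [hx, norm_smul]
    have h3 := norm_add_le Z.1 (star Z.2)
    have : ‖(1 / 2 : ℂ)‖ = 1 / 2 := by norm_num
    rw [this]
    linarith
  · rw [hy, norm_smul]
    have h3 := norm_sub_le Z.1 (star Z.2)
    have : ‖(-Complex.I / 2 : ℂ)‖ = 1 / 2 := by simp
    rw [this]
    linarith

namespace IsDefining

variable {M : Set C3} {r : C3 → ℝ} {R : CVec → ℂ} {p : C3}

lemma extension_apply_eq_zero (h : IsDefining M r R p) (hp : p ∈ M) : R (realVec p) = 0 := by
  rw [h.restrict.self_of_nhds, h.apply_eq_zero hp, Complex.ofReal_zero]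

/-- A holomorphic function that vanishes at the real points of `M` vanishes on the complexification
`{R = 0}` of `M`. -/
theorem eventually_eq_zero_of_restrict {F : Type*} [NormedAddCommGroup F] [NormedSpace ℂ F]
    [CompleteSpace F] (h : IsDefining M r R p) (hp : p ∈ M) {H : CVec → F}
    (hH : AnalyticAt ℂ H (realVec p)) (hH0 : ∀ᶠ x in 𝓝[M] p, H (realVec x) = 0) :
    ∀ᶠ Z in 𝓝 (realVec p), R Z = 0 → H Z = 0 := by
  obtain ⟨v, hv⟩ := h.exists_fderiv_eq_one
  obtain ⟨e, he, hes, hep, hec, -, her⟩ :=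
    exists_straightening h.analyticAt_real.contDiffAt (h.apply_eq_zero hp) hv
  obtain ⟨Φ, hΦ, hΦs, hΦp, hΦc, -, hΦR⟩ :=
    exists_straightening (v := realVec v) h.analyticAt.contDiffAt (h.extension_apply_eq_zero hp)
      (by rw [h.fderiv_realVec, hv, Complex.ofReal_one])
  have hsymm : e.symm p = p := by
    have := e.left_inv hes
    rwa [hep] at this
  have htgt : p ∈ e.target := by
    have := e.map_source hes
    rwa [hep] at this
  have hΦsymm : Φ.symm (realVec p) = realVec p := by
    have := Φ.left_inv hΦs
    rwa [hΦp] at this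
  -- Built with the same `v`, the chart `Φ` extends `e`. So {R = 0} becomes a complex hyperplane
  -- whose real points correspond to `M`.
  have hcomm : ∀ᶠ x in 𝓝 p, Φ (realVec x) = realVec (e x) := by
    filter_upwards [h.restrict] with x hx
    rw [hΦ, he, hx, ← realVec_sub, h.fderiv_realVec, realVec_add, realVec_smul,
      ← Complex.ofReal_sub, Complex.coe_smul]
  have hecont : Tendsto e.symm (𝓝 p) (𝓝 p) := by
    have := (hec.differentiableAt (by simp)).continuousAt.tendsto
    rwa [hsymm] at this
  have hreal : ∀ᶠ y in 𝓝 p, fderiv ℝ r p (y - p) = 0 → H (Φ.symm (realVec y)) = 0 := by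
    have h1 : ∀ᶠ x in 𝓝 p, realVec x ∈ Φ.source :=
      continuous_realVec.continuousAt.eventually (Φ.open_source.mem_nhds hΦs)
    rw [eventually_nhdsWithin_iff] at hH0
    filter_upwards [hecont.eventually hcomm, hecont.eventually h1, e.open_target.mem_nhds htgt,
      hecont.eventually h.mem_iff, hecont.eventually hH0] with y a1 a2 a3 a4 a5 hy
    have hMy : e.symm y ∈ M := by
      rw [a4, ← her, e.right_inv a3, hy]
    rw [e.right_inv a3] at a1
    rw [← a1, Φ.left_inv a2]
    exact a5 hMy
  have hdiff : ∀ᶠ Y in 𝓝 (realVec p), DifferentiableAt ℂ (fun Y => H (Φ.symm Y)) Y := by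
    have h1 : AnalyticAt ℂ (fun Y => H (Φ.symm Y)) (realVec p) :=
      AnalyticAt.comp_of_eq hH hΦc.analyticAt hΦsymm
    exact h1.eventually_analyticAt.mono fun Y hY => hY.differentiableAt
  obtain ⟨ε₁, hε₁, hreal⟩ := Metric.eventually_nhds_iff_ball.1 hreal
  obtain ⟨ε₂, hε₂, hdiff⟩ := Metric.eventually_nhds_iff_ball.1 hdiff
  obtain ⟨ε, hε, hεε⟩ : ∃ ε > 0, ε ≤ ε₁ ∧ ε ≤ ε₂ :=
    ⟨min ε₁ ε₂, lt_min hε₁ hε₂, min_le_left _ _, min_le_right _ _⟩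
  have hnear : ∀ᶠ Z in 𝓝 (realVec p), Φ Z ∈ Metric.ball (realVec p) (ε / 4) := by
    have := (Φ.continuousAt hΦs).tendsto
    rw [hΦp] at this
    exact this.eventually (Metric.ball_mem_nhds _ (by positivity))
  filter_upwards [hnear, Φ.open_source.mem_nhds hΦs] with Z hZ hZs hRZ
  obtain ⟨a, b, hab, ha, hb⟩ := h.exists_realVec_of_fderiv_eq_zero
    (Z := Φ Z - realVec p) (by rw [hΦR, hRZ])
  obtain ⟨hna, hnb⟩ := norm_le_of_eq_realVec_add hab
  rw [Metric.mem_ball, dist_eq_norm] at hZ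
  -- A complex line in that hyperplane: real `t` gives real points, where `H` vanishes, and `t = I`
  -- gives `Φ Z`. The bounds ‖a‖, ‖b‖ < ε/4 keep it in the ε-ball for |t| < 2, and the one-variable
  -- identity theorem concludes.
  let c : ℂ → CVec := fun t => realVec p + (realVec a + t • realVec b)
  have hcball : ∀ t ∈ Metric.ball (0 : ℂ) 2, c t ∈ Metric.ball (realVec p) ε := by
    intro t ht
    rw [mem_ball_zero_iff] at ht
    rw [Metric.mem_ball, dist_eq_norm]
    have h1 : c t - realVec p = realVec a + t • realVec b := by simp [c]
    rw [h1]
    have h2 := norm_add_le (realVec a) (t • realVec b)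
    rw [norm_smul, norm_realVec, norm_realVec] at h2
    have h3 : ‖t‖ * ‖b‖ ≤ 2 * ‖b‖ := by gcongr
    linarith
  let g : ℂ → F := fun t => H (Φ.symm (c t))
  have hg : AnalyticOnNhd ℂ g (Metric.ball 0 2) := by
    refine DifferentiableOn.analyticOnNhd (fun t ht => ?_) Metric.isOpen_ball
    have h1 := hdiff _ (Metric.ball_subset_ball hεε.2 (hcball t ht))
    have h2 : DifferentiableAt ℂ c t := by fun_prop
    exact (h1.comp t h2).differentiableWithinAt
  have hg0 : ∀ t : ℝ, |t| < 2 → g t = 0 := by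
    intro t ht
    have h1 : c t = realVec (p + (a + t • b)) := by
      simp only [c]
      rw [realVec_add, realVec_add, realVec_smul, Complex.coe_smul]
    have h2 : c t ∈ Metric.ball (realVec p) ε := hcball t (by simpa using ht)
    rw [h1, Metric.mem_ball, dist_eq_norm, ← realVec_sub, norm_realVec, ← dist_eq_norm] at h2
    simp only [g]
    rw [h1]
    refine hreal _ (Metric.ball_subset_ball hεε.1 h2) ?_
    rw [add_sub_cancel_left, map_add, map_smul, ha, hb]
    simp
  have hfreq : ∃ᶠ t in 𝓝[≠] (0 : ℂ), g t = 0 := by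
    have htend : Tendsto (fun t : ℝ => (t : ℂ)) (𝓝[≠] 0) (𝓝[≠] 0) := by
      refine tendsto_nhdsWithin_iff.2 ⟨?_, ?_⟩
      · have := (Complex.continuous_ofReal.tendsto 0)
        rw [Complex.ofReal_zero] at this
        exact this.mono_left nhdsWithin_le_nhds
      · filter_upwards [self_mem_nhdsWithin] with t ht
        simpa using ht
    refine htend.frequently (Filter.Eventually.frequently ?_)
    have : ∀ᶠ t in 𝓝 (0 : ℝ), |t| < 2 := by
      filter_upwards [Metric.ball_mem_nhds (0 : ℝ) two_pos] with t ht
      simpa using ht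
    filter_upwards [nhdsWithin_le_nhds this] with t ht using hg0 t ht
  have hz := hg.eqOn_zero_of_preconnected_of_frequently_eq_zero
    (convex_ball 0 2).isPreconnected (Metric.mem_ball_self two_pos) hfreq
    (show Complex.I ∈ Metric.ball 0 2 by simp)
  have hcI : c Complex.I = Φ Z := by
    simp only [c]
    rw [← hab]
    abel
  simp only [g, hcI, Φ.left_inv hZs] at hz
  exact hz

end IsDefining

/-! ### The Levi kernel as a real-analytic field satisfying the tangential Cauchy-Riemann equations
-/

/-- The kernel of two independent linear forms on `ℂ³` is a line. -/
lemma exists_smul_eq_of_ker {α β : C3 →L[ℂ] ℂ} {u w k : C3} (hαu : α u = 0) (hβu : β u ≠ 0)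
    (hαw : α w = 1) (hk : k ≠ 0) (hαk : α k = 0) (hβk : β k = 0) {x : C3} (hαx : α x = 0)
    (hβx : β x = 0) : ∃ c : ℂ, x = c • k := by
  let T : C3 →ₗ[ℂ] ℂ × ℂ := (α : C3 →ₗ[ℂ] ℂ).prod (β : C3 →ₗ[ℂ] ℂ)
  have hT : ∀ y, T y = (α y, β y) := fun y => rfl
  have hsurj : LinearMap.range T = ⊤ := by
    rw [LinearMap.range_eq_top]
    rintro ⟨s, t⟩
    refine ⟨s • w + ((t - s * β w) / β u) • u, ?_⟩
    rw [hT]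
    simp [hαu, hαw, hβu]
  have hfin := LinearMap.finrank_range_add_finrank_ker T
  rw [hsurj, finrank_top] at hfin
  simp only [Module.finrank_prod, Module.finrank_self, Module.finrank_fintype_fun_eq_card,
    Fintype.card_fin] at hfin
  have hker : Module.finrank ℂ (LinearMap.ker T) = 1 := by omega
  have hkT : k ∈ LinearMap.ker T := by simp [hT, hαk, hβk]
  have hxT : x ∈ LinearMap.ker T := by simp [hT, hαx, hβx]
  obtain ⟨c, hc⟩ := (finrank_eq_one_iff_of_nonzero' (⟨k, hkT⟩ : LinearMap.ker T)
    (fun h0 => hk (congrArg Subtype.val h0))).1 hker ⟨x, hxT⟩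
  exact ⟨c, (congrArg Subtype.val hc).symm⟩

lemma analyticAt_clm_apply {E F G : Type*} [NormedAddCommGroup E] [NormedSpace ℂ E]
    [NormedAddCommGroup F] [NormedSpace ℂ F] [CompleteSpace F] [NormedAddCommGroup G]
    [NormedSpace ℂ G] [CompleteSpace G] {f : E → F →L[ℂ] G} {g : E → F} {x : E}
    (hf : AnalyticAt ℂ f x) (hg : AnalyticAt ℂ g x) : AnalyticAt ℂ (fun y => f y (g y)) x :=
  (hf.contDiffAt.clm_apply hg.contDiffAt).analyticAt

namespace IsDefining

variable {M : Set C3} {r : C3 → ℝ} {R : CVec → ℂ} {p : C3}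

lemma exists_fderiv_inr_eq_one (h : IsDefining M r R p) :
    ∃ b, fderiv ℂ R (realVec p) (0, b) = 1 := by
  obtain ⟨a, ha⟩ := h.exists_fderiv_inl_eq_one
  exact ⟨star a, by rw [h.fderiv_inr_star, ha, star_one]⟩

/-- Near `p`, the kernel of the Levi form is generated by a real-analytic field, which can be
normalized by a linear form. -/
theorem exists_kernel_field (h : IsDefining M r R p) (hp : p ∈ M)
    (hLevi : ∀ q ∈ M, HasLeviRank M q 1) :
    ∃ (ξ : C3 →L[ℂ] ℂ) (K : C3 → C3), AnalyticAt ℝ K p ∧ (∀ᶠ x in 𝓝 p, ξ (K x) = 1) ∧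
      ∀ᶠ x in 𝓝[M] p, (K x, 0) ∈ K10 M x := by
  obtain ⟨k, hk0, hkK, -, a, b, ha, hb, hab⟩ := h.exists_generator_K10 hp (hLevi p hp)
  obtain ⟨-, hkT, hkhess⟩ := (h.mem_K10_iff hp).1 hkK
  obtain ⟨v, hv⟩ := h.exists_fderiv_inr_eq_one
  obtain ⟨w, hw⟩ := h.exists_fderiv_inl_eq_one
  obtain ⟨ξ, hξ⟩ : ∃ ξ : C3 →L[ℂ] ℂ, ξ k ≠ 0 := by
    obtain ⟨i, hi⟩ := Function.ne_iff.1 hk0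
    exact ⟨ContinuousLinearMap.proj i, hi⟩
  let R' : CVec → CVec →L[ℂ] ℂ := fderiv ℂ R
  have hR' : AnalyticAt ℂ R' (realVec p) := h.analyticAt.fderiv
  have hR'' : AnalyticAt ℂ (fderiv ℂ R') (realVec p) := hR'.fderiv
  have hR'app : ∀ Z, AnalyticAt ℂ (fun Y => R' Y Z) (realVec p) := fun Z =>
    ((ContinuousLinearMap.apply ℂ ℂ Z).analyticAt _).comp hR'
  have hvne : R' (realVec p) (0, v) ≠ 0 := by
    show fderiv ℂ R (realVec p) (0, v) ≠ 0
    rw [hv]; exact one_ne_zero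
  let y : CVec → C3 := fun Z => b - (R' Z (0, b) / R' Z (0, v)) • v
  have hy : AnalyticAt ℂ y (realVec p) :=
    analyticAt_const.sub (((hR'app _).div (hR'app _) hvne).smul analyticAt_const)
  have hyp : y (realVec p) = b := by
    simp [y, R', hb]
  let inl := ContinuousLinearMap.inl ℂ C3 C3
  let inr := ContinuousLinearMap.inr ℂ C3 C3
  -- The kernel generator solves the linear system with right-hand side (1, 0, 0): normalization,
  -- tangency, and a single Hessian equation against the (0,1) vector `y Z`, enough because the Levi
  -- form has rank one.
  let A : CVec → C3 →L[ℂ] ℂ × ℂ × ℂ := fun Z =>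
    ξ.prod (((R' Z).comp inl).prod ((fderiv ℂ R' Z (inr (y Z))).comp inl))
  have hA : AnalyticAt ℂ A (realVec p) := by
    let pre : (CVec →L[ℂ] ℂ) →L[ℂ] (C3 →L[ℂ] ℂ) :=
      (ContinuousLinearMap.compL ℂ C3 CVec ℂ).flip inl
    have h1 : AnalyticAt ℂ (fun Z => (R' Z).comp inl) (realVec p) := (pre.analyticAt _).comp hR'
    have h2 : AnalyticAt ℂ (fun Z => (fderiv ℂ R' Z (inr (y Z))).comp inl) (realVec p) :=
      (pre.analyticAt _).comp (analyticAt_clm_apply hR'' ((inr.analyticAt _).comp hy))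
    let P₂ : ((C3 →L[ℂ] ℂ) × (C3 →L[ℂ] ℂ)) →L[ℂ] (C3 →L[ℂ] ℂ × ℂ) :=
      (ContinuousLinearMap.prodₗᵢ ℂ).toContinuousLinearEquiv.toContinuousLinearMap
    let P₃ : ((C3 →L[ℂ] ℂ) × (C3 →L[ℂ] ℂ × ℂ)) →L[ℂ] (C3 →L[ℂ] ℂ × ℂ × ℂ) :=
      (ContinuousLinearMap.prodₗᵢ ℂ).toContinuousLinearEquiv.toContinuousLinearMap
    have h4 : AnalyticAt ℂ (fun Z => P₂ ((R' Z).comp inl,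
        (fderiv ℂ R' Z (inr (y Z))).comp inl)) (realVec p) :=
      (P₂.analyticAt _).comp (h1.prod h2)
    exact (P₃.analyticAt _).comp (analyticAt_const.prod h4)
  have hAapp : ∀ Z x, A Z x = (ξ x, R' Z (x, 0), fderiv ℂ R' Z (0, y Z) (x, 0)) := fun Z x => rfl
  -- At `p` the last two equations cut out the line ℂ k, since the Hessian is nonzero at (b, a), and
  -- `ξ` is injective on that line.
  have hinj : Function.Injective (A (realVec p)) := by
    rw [injective_iff_map_eq_zero]
    intro x hx
    rw [hAapp, hyp] at hx
    have e1 : ξ x = 0 := congrArg Prod.fst hx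
    have e2 : fderiv ℂ R (realVec p) (x, 0) = 0 := congrArg (fun t => t.2.1) hx
    have e3 : hess R p (0, b) (x, 0) = 0 := congrArg (fun t => t.2.2) hx
    obtain ⟨c, rfl⟩ := exists_smul_eq_of_ker (α := (fderiv ℂ R (realVec p)).comp inl)
      (β := (hess R p (0, b)).comp inl) ha hab hw hk0 hkT (hkhess b hb) e2 e3
    rw [map_smul, smul_eq_mul, mul_eq_zero, or_iff_left hξ] at e1
    rw [e1, zero_smul]
  obtain ⟨T, hT⟩ : ∃ T : C3 ≃L[ℂ] ℂ × ℂ × ℂ, (T : C3 →L[ℂ] ℂ × ℂ × ℂ) = A (realVec p) := by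
    refine ⟨(LinearEquiv.ofInjectiveOfFinrankEq (A (realVec p) : C3 →ₗ[ℂ] ℂ × ℂ × ℂ) hinj
      (by simp)).toContinuousLinearEquiv, ?_⟩
    ext x <;> rfl
  let κ : CVec → C3 := fun Z => (A Z).inverse (1, 0, 0)
  have hκ : AnalyticAt ℂ κ (realVec p) := by
    have h1 : AnalyticAt ℂ ContinuousLinearMap.inverse (A (realVec p)) := by
      rw [← hT]; exact (contDiffAt_map_inverse T).analyticAt
    have h2 : AnalyticAt ℂ (fun Z => (A Z).inverse) (realVec p) := h1.comp hA
    exact analyticAt_clm_apply h2 analyticAt_const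
  have hinv : ∀ᶠ Z in 𝓝 (realVec p), ∃ S : C3 ≃L[ℂ] ℂ × ℂ × ℂ, (S : C3 →L[ℂ] _) = A Z := by
    have h1 := ContinuousLinearEquiv.nhds T
    rw [hT] at h1
    exact hA.continuousAt.eventually h1
  have hAκ : ∀ᶠ Z in 𝓝 (realVec p), Function.Injective (A Z) ∧ A Z (κ Z) = (1, 0, 0) := by
    filter_upwards [hinv] with Z hZ
    obtain ⟨S, hS⟩ := hZ
    simp only [κ]
    rw [← hS, ContinuousLinearMap.inverse_equiv]
    exact ⟨S.injective, S.apply_symm_apply _⟩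
  have hAκ' := continuous_realVec.continuousAt.eventually hAκ
  refine ⟨ξ, fun x => κ (realVec x), analyticAt_comp_realVec hκ, ?_, ?_⟩
  · filter_upwards [hAκ'] with x hx
    exact congrArg Prod.fst hx.2
  · have hne : ∀ᶠ x in 𝓝 p, R' (realVec x) (0, v) ≠ 0 :=
      continuous_realVec.continuousAt.eventually ((hR'app (0, v)).continuousAt.eventually_ne hvne)
    filter_upwards [nhdsWithin_le_nhds hAκ', nhdsWithin_le_nhds h.eventually,
      nhdsWithin_le_nhds hne, self_mem_nhdsWithin] with x hx hdef hvx hxM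
    -- A generator `g` of the true kernel satisfies both homogeneous equations, so by uniqueness the
    -- solution is `g` rescaled by `ξ g`.
    obtain ⟨g, hg0, hgK, -, -⟩ := hdef.exists_generator_K10 hxM (hLevi x hxM)
    obtain ⟨-, hgT, hgH⟩ := (hdef.mem_K10_iff hxM).1 hgK
    have hyx : fderiv ℂ R (realVec x) (0, y (realVec x)) = 0 := by
      have e : ((0, y (realVec x)) : CVec) =
          (0, b) - (R' (realVec x) (0, b) / R' (realVec x) (0, v)) • (0, v) := by simp [y]
      rw [e, map_sub, map_smul, smul_eq_mul]
      exact sub_eq_zero.2 (div_mul_cancel₀ _ hvx).symm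
    have hAg : A (realVec x) g = (ξ g, 0, 0) := by
      rw [hAapp]
      exact Prod.ext rfl (Prod.ext hgT (hgH _ hyx))
    have hξg : ξ g ≠ 0 := by
      intro h0
      rw [h0] at hAg
      exact hg0 (hx.1 (hAg.trans (map_zero _).symm))
    have hκg : κ (realVec x) = (ξ g)⁻¹ • g := by
      refine hx.1 (hx.2.trans ?_)
      rw [map_smul, hAg]
      simp [hξg]
    rw [hκg]
    have : (((ξ g)⁻¹ • g, 0) : CVec) = (ξ g)⁻¹ • (g, 0) := by simp
    rw [this]
    exact Submodule.smul_mem _ _ hgK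

/-- If the Freeman form vanishes, the normalized generator of the Levi kernel satisfies the
tangential Cauchy-Riemann equations. -/
theorem complexify_fderiv_kernel_field (h : IsDefining M r R p) (hLevi : ∀ q ∈ M, HasLeviRank M q 1)
    (hF : ∀ q ∈ M, FreemanFormVanishesAt M q) {ξ : C3 →L[ℂ] ℂ} {K : C3 → C3}
    (hK : AnalyticAt ℝ K p) (hξ : ∀ᶠ x in 𝓝 p, ξ (K x) = 1)
    (hKK : ∀ᶠ x in 𝓝[M] p, (K x, 0) ∈ K10 M x) :
    ∀ᶠ x in 𝓝[M] p, ∀ b, fderiv ℂ R (realVec x) (0, b) = 0 →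
      complexify (fderiv ℝ K x) (0, b) = 0 := by
  filter_upwards [nhdsWithin_le_nhds h.eventually, nhdsWithin_le_nhds hK.eventually_analyticAt,
    nhdsWithin_le_nhds (eventually_eventually_nhds.2 hξ),
    eventually_eventually_nhdsWithin.2 hKK, self_mem_nhdsWithin] with x hx hKx hξx hKKx hxM b hb
  have hKs : IsLocalSection M (K10 M) x fun y => (K y, 0) := ⟨hKx.prod analyticAt_const, hKKx⟩
  have hKT : IsLocalSection M (T10 M) x fun y => (K y, 0) :=
    ⟨hKx.prod analyticAt_const, hKKx.mono fun y hy => hy.1⟩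
  obtain ⟨L, hL, hLx⟩ := hx.exists_section ((hx.fderiv_inr_eq_zero_iff b).1 hb)
  have h0 := hF x hxM _ L hKs hL
  rw [freemanForm, Submodule.Quotient.mk_eq_zero, Submodule.mem_sup] at h0
  obtain ⟨Y, hY, Z, hZ, hYZ⟩ := h0
  have e1 := hx.bracket_fst hxM hKT hL
  rw [← hYZ, hLx, star_star, Prod.fst_add, ((hx.mem_T01_iff hxM).1 hZ).1, add_zero] at e1
  -- Since ξ(K) is constant, the derivative of `K` lies in ker ξ. The Freeman form puts it in the
  -- kernel line, on which `ξ` is injective, so it is zero.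
  have e2 : ξ (complexify (fderiv ℝ K x) (0, b)) = 0 := by
    rw [map_complexify_fderiv ξ hKx.differentiableAt]
    have : fderiv ℝ (fun y => ξ (K y)) x = 0 :=
      ((hasFDerivAt_const (1 : ℂ) x).congr_of_eventuallyEq hξx).fderiv
    rw [this]
    simp [complexify]
  obtain ⟨g, -, -, hg, -⟩ := hx.exists_generator_K10 hxM (hLevi x hxM)
  obtain ⟨c, hc⟩ := hg _ hY
  obtain ⟨d, hd⟩ := hg _ (hKKx.self_of_nhdsWithin hxM)
  have hc1 : Y.1 = c • g := congrArg Prod.fst hc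
  have hd1 : K x = d • g := congrArg Prod.fst hd
  have hξ1 := hξx.self_of_nhds
  rw [hd1, map_smul, smul_eq_mul] at hξ1
  have hξg : ξ g ≠ 0 := right_ne_zero_of_mul (hξ1 ▸ one_ne_zero)
  have e3 : complexify (fderiv ℝ K x) (0, b) = -(c • g) := by
    rw [← hc1, e1, neg_neg]
  rw [e3, map_neg, map_smul, neg_eq_zero, smul_eq_mul, mul_eq_zero, or_iff_left hξg] at e2
  rw [e3, e2, zero_smul, neg_zero]

end IsDefining

/-! ### Segre functions and coordinates straightening the Levi kernel -/

open scoped ContDiff in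
/-- Solving `R (Z + t • w) = 0` for `t`. -/
lemma exists_implicit_translation {E : Type*} [NormedAddCommGroup E] [NormedSpace ℂ E]
    [CompleteSpace E] {R : E → ℂ} {P w : E} (hR : AnalyticAt ℂ R P) (hP : R P = 0)
    (hw : fderiv ℂ R P w = 1) :
    ∃ θ : E → ℂ, AnalyticAt ℂ θ P ∧ θ P = 0 ∧ (∀ᶠ Z in 𝓝 P, R (Z + θ Z • w) = 0) ∧
      ∀ᶠ Z in 𝓝 P, R Z = 0 → θ Z = 0 := by
  let f : E × ℂ → ℂ := fun u => R (u.1 + u.2 • w)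
  let s : E × ℂ →L[ℂ] E := ContinuousLinearMap.fst ℂ E ℂ +
    (ContinuousLinearMap.snd ℂ E ℂ).smulRight w
  have hs : ∀ u, s u = u.1 + u.2 • w := fun u => rfl
  have hs0 : s (P, 0) = P := by simp [hs]
  have hf : ContDiffAt ℂ ω f (P, 0) := by
    have : AnalyticAt ℂ (fun u => R (s u)) (P, 0) :=
      AnalyticAt.comp_of_eq hR (s.analyticAt _) hs0
    exact this.contDiffAt
  have hfd : fderiv ℂ f (P, 0) = (fderiv ℂ R P).comp s := by
    have h1 : HasFDerivAt R (fderiv ℂ R P) (s (P, 0)) := by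
      rw [hs0]; exact hR.differentiableAt.hasFDerivAt
    exact (h1.comp (P, (0 : ℂ)) s.hasFDerivAt).fderiv
  have hinv : (fderiv ℂ f (P, 0) ∘L .inr ℂ E ℂ).IsInvertible := by
    refine ⟨ContinuousLinearEquiv.refl ℂ ℂ, ?_⟩
    ext
    simp [hfd, hs, hw]
  have hn : (ω : WithTop ℕ∞) ≠ 0 := by simp
  have hf0 : f (P, 0) = 0 := by simp [f, hP]
  refine ⟨hf.implicitFunction hn hinv, (hf.contDiffAt_implicitFunction hn hinv).analyticAt,
    hf.implicitFunction_apply_self hn hinv, ?_, ?_⟩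
  · have := hf.eventually_apply_implicitFunction hn hinv
    rw [hf0] at this
    exact this
  · have h1 := hf.eventually_apply_eq_iff_implicitFunction hn hinv
    have h2 : Tendsto (fun Z : E => (Z, (0 : ℂ))) (𝓝 P) (𝓝 (P, 0)) :=
      (by fun_prop : Continuous fun Z : E => (Z, (0 : ℂ))).tendsto P
    filter_upwards [h2.eventually h1] with Z hZ hRZ
    refine hZ.1 ?_
    simp [f, hRZ, hP]

namespace IsDefining

variable {M : Set C3} {r : C3 → ℝ} {R : CVec → ℂ} {p : C3}

/-- The holomorphic extension of a field satisfying the tangential Cauchy-Riemann equations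
satisfies them on the complexification of `M`. -/
lemma eventually_fderiv_inr_eq_zero (h : IsDefining M r R p) (hp : p ∈ M) {K : C3 → C3}
    {κ : CVec → C3} (hκ : AnalyticAt ℂ κ (realVec p)) (hκK : ∀ᶠ x in 𝓝 p, κ (realVec x) = K x)
    (hCR : ∀ᶠ x in 𝓝[M] p, ∀ b, fderiv ℂ R (realVec x) (0, b) = 0 →
      complexify (fderiv ℝ K x) (0, b) = 0) :
    ∀ᶠ Z in 𝓝 (realVec p), R Z = 0 → ∀ b, fderiv ℂ R Z (0, b) = 0 →
      fderiv ℂ κ Z (0, b) = 0 := by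
  obtain ⟨v, hv⟩ := h.exists_fderiv_inr_eq_one
  let inr := ContinuousLinearMap.inr ℂ C3 C3
  -- `H Z u` is dκ on (0, R_v u - R_u v), with R_u = dR(0, u); this vector is annihilated by dR. All
  -- the tangential equations become one holomorphic equation, to which the identity principle
  -- applies.
  let H : CVec → C3 →L[ℂ] C3 := fun Z => fderiv ℂ R Z (0, v) • (fderiv ℂ κ Z).comp inr -
    ((fderiv ℂ R Z).comp inr).smulRight (fderiv ℂ κ Z (0, v))
  have hHapp : ∀ Z u, H Z u = fderiv ℂ R Z (0, v) • fderiv ℂ κ Z (0, u) -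
    fderiv ℂ R Z (0, u) • fderiv ℂ κ Z (0, v) := fun Z u => rfl
  have hRv : AnalyticAt ℂ (fun Z => fderiv ℂ R Z (0, v)) (realVec p) :=
    analyticAt_clm_apply h.analyticAt.fderiv analyticAt_const
  have hH : AnalyticAt ℂ H (realVec p) := by
    have h1 : AnalyticAt ℂ (fun Z => (fderiv ℂ κ Z).comp inr) (realVec p) :=
      (((ContinuousLinearMap.compL ℂ C3 CVec C3).flip inr).analyticAt _).comp hκ.fderiv
    have h2 : AnalyticAt ℂ (fun Z => (fderiv ℂ R Z).comp inr) (realVec p) :=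
      (((ContinuousLinearMap.compL ℂ C3 CVec ℂ).flip inr).analyticAt _).comp h.analyticAt.fderiv
    have h3 : AnalyticAt ℂ (fun Z => fderiv ℂ κ Z (0, v)) (realVec p) :=
      analyticAt_clm_apply hκ.fderiv analyticAt_const
    exact (hRv.smul h1).sub (h2.contDiffAt.smulRight h3.contDiffAt).analyticAt
  have hH0 : ∀ᶠ x in 𝓝[M] p, H (realVec x) = 0 := by
    have h1 := continuous_realVec.continuousAt.eventually hκ.eventually_analyticAt
    filter_upwards [hCR, nhdsWithin_le_nhds h1,
      nhdsWithin_le_nhds (eventually_eventually_nhds.2 hκK)] with x hx hx1 hx2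
    ext1 u
    rw [hHapp]
    have e : ((0, fderiv ℂ R (realVec x) (0, v) • u - fderiv ℂ R (realVec x) (0, u) • v) : CVec) =
        fderiv ℂ R (realVec x) (0, v) • (0, u) - fderiv ℂ R (realVec x) (0, u) • (0, v) := by
      simp
    have h2 := hx (fderiv ℂ R (realVec x) (0, v) • u - fderiv ℂ R (realVec x) (0, u) • v) (by
      rw [e, map_sub, map_smul, map_smul, smul_eq_mul, smul_eq_mul, mul_comm, sub_self])
    rw [complexify_fderiv hx1.differentiableAt hx2, e, map_sub, map_smul, map_smul] at h2
    exact h2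
  have hne : ∀ᶠ Z in 𝓝 (realVec p), fderiv ℂ R Z (0, v) ≠ 0 :=
    hRv.continuousAt.eventually_ne (by rw [hv]; exact one_ne_zero)
  filter_upwards [h.eventually_eq_zero_of_restrict hp hH hH0, hne] with Z h1 h2 hRZ b hb
  have h3 : H Z b = 0 := by rw [h1 hRZ]; rfl
  rw [hHapp, hb, zero_smul, sub_zero, smul_eq_zero, or_iff_right h2] at h3
  exact h3

/-- If the Freeman form vanishes, there are local holomorphic coordinates in which the kernel of
the Levi form is the last coordinate direction. -/
theorem exists_straightening_coordinates (h : IsDefining M r R p) (hp : p ∈ M)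
    (hLevi : ∀ q ∈ M, HasLeviRank M q 1) (hF : ∀ q ∈ M, FreemanFormVanishesAt M q) :
    ∃ (φ : C3 → (Fin 2 → ℂ) × ℂ) (T : C3 ≃L[ℂ] (Fin 2 → ℂ) × ℂ) (K : C3 → C3),
      AnalyticAt ℂ φ p ∧ HasFDerivAt φ (T : C3 →L[ℂ] (Fin 2 → ℂ) × ℂ) p ∧
      ∀ᶠ x in 𝓝[M] p, fderiv ℂ φ x (K x) = (0, 1) ∧ fderiv ℂ R (realVec x) (K x, 0) = 0 := by
  obtain ⟨ξ, K, hK, hξ, hKK⟩ := h.exists_kernel_field hp hLevi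
  have hCR := h.complexify_fderiv_kernel_field hLevi hF hK hξ hKK
  obtain ⟨κ, hκ, hκK⟩ := exists_holomorphic_extension hK
  have hKT : ∀ᶠ x in 𝓝[M] p, fderiv ℂ R (realVec x) (K x, 0) = 0 := by
    filter_upwards [hKK, nhdsWithin_le_nhds h.eventually, self_mem_nhdsWithin] with x h1 h2 h3
    exact ((h2.mem_K10_iff h3).1 h1).2.1
  have hκR : ∀ᶠ Z in 𝓝 (realVec p), R Z = 0 → fderiv ℂ R Z (κ Z, 0) = 0 := by
    refine h.eventually_eq_zero_of_restrict hp (H := fun Z => fderiv ℂ R Z (κ Z, 0)) ?_ ?_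
    · exact analyticAt_clm_apply h.analyticAt.fderiv (hκ.prod analyticAt_const)
    · filter_upwards [hKT, nhdsWithin_le_nhds hκK] with x h1 h2
      rw [h2, h1]
  have hκCR := h.eventually_fderiv_inr_eq_zero hp hκ hκK hCR
  obtain ⟨v, hv⟩ := h.exists_fderiv_inr_eq_one
  obtain ⟨w, hw⟩ := h.exists_fderiv_inl_eq_one
  obtain ⟨-, -, -, -, a, b, ha, hb, hab⟩ := h.exists_generator_K10 hp (hLevi p hp)
  obtain ⟨θ, hθ, hθP, hθR, hθ0⟩ :=
    exists_implicit_translation h.analyticAt (h.extension_apply_eq_zero hp) hv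
  -- `σ` retracts a neighborhood onto {R = 0}, moving points only along (0, v) and hence keeping `z`
  -- fixed.
  let σ : CVec → CVec := fun Z => Z + θ Z • (0, v)
  have hσP : σ (realVec p) = realVec p := by simp [σ, hθP]
  have hσ : AnalyticAt ℂ σ (realVec p) := analyticAt_id.add (hθ.smul analyticAt_const)
  have hσt : Tendsto σ (𝓝 (realVec p)) (𝓝 (realVec p)) := by
    have := hσ.continuousAt.tendsto
    rwa [hσP] at this
  have hne : ∀ᶠ Z in 𝓝 (realVec p), fderiv ℂ R Z (0, v) ≠ 0 :=
    (analyticAt_clm_apply h.analyticAt.fderiv analyticAt_const).continuousAt.eventually_ne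
      (by rw [hv]; exact one_ne_zero)
  have hgood := hθ.eventually_analyticAt.and <| (eventually_eventually_nhds.2 hθR).and <|
    hθ0.and <| hσt.eventually <| h.analyticAt.eventually_analyticAt.and <|
    hκ.eventually_analyticAt.and <| hne.and <| hκR.and hκCR
  obtain ⟨δ₁, hδ₁, hgood⟩ := Metric.eventually_nhds_iff_ball.1 hgood
  obtain ⟨δ₂, hδ₂, hreal⟩ := Metric.eventually_nhds_iff_ball.1 (hκK.and (h.mem_iff.and h.restrict))
  obtain ⟨δ, hδ, hδδ⟩ : ∃ δ > 0, δ ≤ δ₁ ∧ δ ≤ δ₂ :=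
    ⟨min δ₁ δ₂, lt_min hδ₁ hδ₂, min_le_left _ _, min_le_right _ _⟩
  have hmemball : ∀ z ∈ Metric.ball p δ, ∀ s ∈ Metric.ball (star p) δ,
      ((z, s) : CVec) ∈ Metric.ball (realVec p) δ₁ := by
    intro z hz s hs
    refine Metric.ball_subset_ball hδδ.1 ?_
    rw [realVec, ← ball_prod_same]
    exact ⟨hz, hs⟩
  have hσd : ∀ Z ∈ Metric.ball (realVec p) δ₁, HasFDerivAt σ
      (ContinuousLinearMap.id ℂ CVec + (fderiv ℂ θ Z).smulRight ((0, v) : CVec)) Z := fun Z hZ =>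
    (hasFDerivAt_id Z).add ((hgood Z hZ).1.differentiableAt.hasFDerivAt.smul_const _)
  have hstar : ∀ Z ∈ Metric.ball (realVec p) δ₁, ∀ u,
      fderiv ℂ R (σ Z) u + fderiv ℂ θ Z u * fderiv ℂ R (σ Z) (0, v) = 0 := by
    intro Z hZ u
    obtain ⟨-, h2, -, h4, -⟩ := hgood Z hZ
    have h6 : HasFDerivAt (fun Y => R (σ Y)) _ Z :=
      h4.differentiableAt.hasFDerivAt.comp Z (hσd Z hZ)
    have h7 : HasFDerivAt (fun Y => R (σ Y)) (0 : CVec →L[ℂ] ℂ) Z :=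
      (hasFDerivAt_const (0 : ℂ) Z).congr_of_eventuallyEq h2
    have h8 := congrArg (fun A => A u) (h6.unique h7)
    have h9 : fderiv ℂ R (σ Z) (u + fderiv ℂ θ Z u • (0, v)) = 0 := h8
    rwa [map_add, map_smul, smul_eq_mul] at h9
  have hPball : realVec p ∈ Metric.ball (realVec p) δ₁ := Metric.mem_ball_self hδ₁
  -- For fixed `z`, the curves in σ(z, ·) have velocities (0, b) tangent to {R = 0}, so κ ∘ σ is
  -- constant in `s`. Its value is read at s = z̄, which `σ` fixes together with `z` when z ∈ M.
  have hconst : ∀ z ∈ M, z ∈ Metric.ball p δ → ∀ s ∈ Metric.ball (star p) δ, κ (σ (z, s)) = K z := by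
    intro z hzM hz s hs
    let g : C3 → C3 := fun s => κ (σ (z, s))
    have hgd : ∀ s ∈ Metric.ball (star p) δ, HasFDerivAt g (0 : C3 →L[ℂ] C3) s := by
      intro s hs
      have hZ := hmemball z hz s hs
      obtain ⟨-, h2, -, -, h5, -, -, h8⟩ := hgood _ hZ
      have h9 : HasFDerivAt (fun s : C3 => ((z, s) : CVec)) (ContinuousLinearMap.inr ℂ C3 C3) s :=
        hasFDerivAt_prodMk_right z s
      have h10 := h5.differentiableAt.hasFDerivAt.comp s ((hσd _ hZ).comp s h9)
      refine h10.congr_fderiv ?_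
      ext1 u
      have e : ((0, u) : CVec) + fderiv ℂ θ (z, s) (0, u) • (0, v) =
          (0, u + fderiv ℂ θ (z, s) (0, u) • v) := by simp
      have e2 := hstar _ hZ (0, u)
      have e3 : fderiv ℂ R (σ (z, s)) (0, u + fderiv ℂ θ (z, s) (0, u) • v) = 0 := by
        rw [← e, map_add, map_smul]
        exact e2
      have e4 := h8 h2.self_of_nhds _ e3
      rw [← e] at e4
      exact e4
    have hzs : star z ∈ Metric.ball (star p) δ := by
      rw [Metric.mem_ball, dist_eq_norm] at hz ⊢
      rwa [← star_sub, norm_star]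
    have h1 : g s = g (star z) :=
      Metric.isOpen_ball.is_const_of_fderiv_eq_zero (𝕜 := ℂ) (convex_ball _ _).isPreconnected
        (fun s hs => (hgd s hs).differentiableAt.differentiableWithinAt)
        (fun s hs => (hgd s hs).fderiv) hs hzs
    obtain ⟨e1, e2, e3⟩ := hreal z (Metric.ball_subset_ball hδδ.2 hz)
    obtain ⟨-, -, h3, -⟩ := hgood _ (hmemball z hz _ hzs)
    have hRz : R (z, star z) = 0 := by
      have : R (z, star z) = r z := e3
      rw [this, e2.1 hzM, Complex.ofReal_zero]
    have e4 : σ (z, star z) = realVec z := by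
      simp only [σ, h3 hRz, zero_smul, add_zero]
      rfl
    show g s = K z
    rw [h1, ← e1, ← e4]
  -- The extended field κ is tangent to {R = 0}, and its value at σ(z, s) is `K z`. Through `hstar`
  -- this says that `K z` annihilates θ(·, s), for every `s`.
  have hint : ∀ z ∈ M, z ∈ Metric.ball p δ → ∀ s ∈ Metric.ball (star p) δ,
      fderiv ℂ θ (z, s) (K z, 0) = 0 := by
    intro z hzM hz s hs
    have hZ := hmemball z hz s hs
    obtain ⟨-, h2, -, -, -, h6, h7, -⟩ := hgood _ hZ
    have e1 := h7 h2.self_of_nhds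
    rw [hconst z hzM hz s hs] at e1
    have e2 := hstar _ hZ (K z, 0)
    rw [e1, zero_add, mul_eq_zero, or_iff_left h6] at e2
    exact e2
  have hpδ : p ∈ Metric.ball p δ := Metric.mem_ball_self hδ
  have hpδ' : star p ∈ Metric.ball (star p) δ := Metric.mem_ball_self hδ
  -- Otherwise dR(a, 0) would vanish at σ(p, s) for all `s`, and differentiating in `s` along `b`
  -- would contradict the nonvanishing of the Hessian at (b, a).
  obtain ⟨s₁, hs₁, hθs₁⟩ : ∃ s₁ ∈ Metric.ball (star p) δ, fderiv ℂ θ (p, s₁) (a, 0) ≠ 0 := by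
    by_contra! hc
    have hθb : fderiv ℂ θ (realVec p) (0, b) = 0 := by
      have := hstar _ hPball (0, b)
      rwa [hσP, hb, hv, zero_add, mul_one] at this
    let c : ℂ → CVec := fun t => realVec p + t • (0, b)
    have hc0 : c 0 = realVec p := by simp [c]
    have hcd : HasDerivAt c (0, b) 0 := by
      have := ((hasDerivAt_id (0 : ℂ)).smul_const ((0, b) : CVec)).const_add (realVec p)
      rw [one_smul] at this
      exact this
    have h1 : HasDerivAt (fun t => σ (c t)) (0, b) 0 := by
      have h2 : HasFDerivAt σ (ContinuousLinearMap.id ℂ CVec +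
          (fderiv ℂ θ (realVec p)).smulRight ((0, v) : CVec)) (c 0) := by
        rw [hc0]; exact hσd _ hPball
      refine (h2.comp_hasDerivAt (0 : ℂ) hcd).congr_deriv ?_
      simp [hθb]
    have h2 : HasDerivAt (fun t => fderiv ℂ R (σ (c t))) (hess R p (0, b)) 0 := by
      have h3 : HasFDerivAt (fderiv ℂ R) (hess R p) (σ (c 0)) := by
        rw [hc0, hσP]; exact h.analyticAt.fderiv.differentiableAt.hasFDerivAt
      exact h3.comp_hasDerivAt (0 : ℂ) h1
    have h4 : HasDerivAt (fun t => fderiv ℂ R (σ (c t)) (a, 0)) (hess R p (0, b) (a, 0)) 0 := by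
      have := h2.clm_apply (hasDerivAt_const (0 : ℂ) ((a, 0) : CVec))
      simpa using this
    have h5 : ∀ᶠ t in 𝓝 (0 : ℂ), fderiv ℂ R (σ (c t)) (a, 0) = 0 := by
      have h6 : ∀ᶠ t in 𝓝 (0 : ℂ), star p + t • b ∈ Metric.ball (star p) δ := by
        have : ContinuousAt (fun t : ℂ => star p + t • b) 0 := by fun_prop
        refine this.eventually ?_
        show _ ∈ 𝓝 (star p + (0 : ℂ) • b)
        rw [zero_smul, add_zero]
        exact Metric.ball_mem_nhds (star p) hδ
      filter_upwards [h6] with t ht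
      have h7 := hstar _ (hmemball p hpδ _ ht) (a, 0)
      have e : c t = (p, star p + t • b) := by simp [c, realVec]
      rw [hc _ ht, zero_mul, add_zero, ← e] at h7
      exact h7
    exact hab (h4.unique ((hasDerivAt_const (0 : ℂ) (0 : ℂ)).congr_of_eventuallyEq h5))
  let s : Fin 2 → C3 := ![star p, s₁]
  have hs : ∀ i, s i ∈ Metric.ball (star p) δ := by
    intro i
    fin_cases i
    · exact hpδ'
    · exact hs₁
  let φ : C3 → (Fin 2 → ℂ) × ℂ := fun z => (fun i => θ (z, s i), ξ z)
  let dφ : C3 → C3 →L[ℂ] (Fin 2 → ℂ) × ℂ := fun z =>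
    (ContinuousLinearMap.pi fun i =>
      (fderiv ℂ θ (z, s i)).comp (ContinuousLinearMap.inl ℂ C3 C3)).prod ξ
  have hφd : ∀ z ∈ Metric.ball p δ, HasFDerivAt φ (dφ z) z := by
    intro z hz
    refine HasFDerivAt.prodMk (hasFDerivAt_pi.2 fun i => ?_) ξ.hasFDerivAt
    exact (hgood _ (hmemball z hz _ (hs i))).1.differentiableAt.hasFDerivAt.comp z
      (hasFDerivAt_prodMk_left z (s i))
  have hφ : AnalyticAt ℂ φ p := by
    refine AnalyticAt.prod (AnalyticAt.pi fun i => ?_) (ξ.analyticAt p)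
    exact AnalyticAt.comp_of_eq (hgood _ (hmemball p hpδ _ (hs i))).1
      (analyticAt_id.prod analyticAt_const) rfl
  have hξp : ξ (K p) = 1 := hξ.self_of_nhds
  have hKp0 : K p ≠ 0 := fun h0 => by
    rw [h0, map_zero] at hξp
    exact zero_ne_one hξp
  -- The differential of θ(·, p̄) at `p` is -dR(·, 0). With that of θ(·, s₁) it cuts out the line of
  -- `K p`, where `ξ` is nonzero.
  have hinj : Function.Injective (dφ p) := by
    rw [injective_iff_map_eq_zero]
    intro u hu
    have e0 : fderiv ℂ θ (p, star p) (u, 0) = 0 := congrArg (fun t => t.1 0) hu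
    have e1 : fderiv ℂ θ (p, s₁) (u, 0) = 0 := congrArg (fun t => t.1 1) hu
    have e2 : ξ u = 0 := congrArg Prod.snd hu
    have e3 : fderiv ℂ R (realVec p) (u, 0) = 0 := by
      have := hstar _ hPball (u, 0)
      rw [show fderiv ℂ θ (realVec p) (u, 0) = 0 from e0, hσP, zero_mul, add_zero] at this
      exact this
    obtain ⟨c, rfl⟩ := exists_smul_eq_of_ker
      (α := (fderiv ℂ R (realVec p)).comp (ContinuousLinearMap.inl ℂ C3 C3))
      (β := (fderiv ℂ θ (p, s₁)).comp (ContinuousLinearMap.inl ℂ C3 C3)) ha hθs₁ hw hKp0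
      (hKT.self_of_nhdsWithin hp) (hint p hp hpδ _ hs₁) e3 e1
    rw [map_smul, hξp, smul_eq_mul, mul_one] at e2
    rw [e2, zero_smul]
  let T : C3 ≃L[ℂ] (Fin 2 → ℂ) × ℂ :=
    (LinearEquiv.ofInjectiveOfFinrankEq (dφ p : C3 →ₗ[ℂ] (Fin 2 → ℂ) × ℂ) hinj
      (by simp)).toContinuousLinearEquiv
  have hT : (T : C3 →L[ℂ] (Fin 2 → ℂ) × ℂ) = dφ p := rfl
  refine ⟨φ, T, K, hφ, hT ▸ hφd p hpδ, ?_⟩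
  filter_upwards [hKT, nhdsWithin_le_nhds hξ, nhdsWithin_le_nhds (Metric.ball_mem_nhds p hδ),
    self_mem_nhdsWithin] with x h1 h2 h3 h4
  refine ⟨?_, h1⟩
  rw [(hφd x h3).fderiv]
  exact Prod.ext (funext fun i => hint x h4 h3 _ (hs i)) h2

end IsDefining

/-! ### Translation invariance and the product structure -/

/-- If a function has vanishing derivative along a subspace at each of its zeros, then its zero set
is locally invariant under the translations of this subspace. -/
theorem exists_ball_zero_invariant {G : Type*} [NormedAddCommGroup G] [NormedSpace ℝ G]
    [CompleteSpace G] {ρ : G → ℝ} {y₀ : G} (hρ : AnalyticAt ℝ ρ y₀) (hρ' : fderiv ℝ ρ y₀ ≠ 0)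
    (h0 : ρ y₀ = 0) (V : Submodule ℝ G)
    (hV : ∀ᶠ y in 𝓝 y₀, ρ y = 0 → ∀ u ∈ V, fderiv ℝ ρ y u = 0) :
    ∃ ε > 0, ∀ y ∈ Metric.ball y₀ ε, ∀ u ∈ V, y + u ∈ Metric.ball y₀ ε → ρ y = 0 →
      ρ (y + u) = 0 := by
  obtain ⟨v, hv⟩ : ∃ v, fderiv ℝ ρ y₀ v = 1 := by
    obtain ⟨v, hv⟩ : ∃ v, fderiv ℝ ρ y₀ v ≠ 0 := by
      by_contra! hc
      exact hρ' (ContinuousLinearMap.ext hc)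
    exact ⟨(fderiv ℝ ρ y₀ v)⁻¹ • v, by simp [hv]⟩
  obtain ⟨e, he, hes, hep, hec, -, her⟩ := exists_straightening hρ.contDiffAt h0 hv
  have hsymm : e.symm y₀ = y₀ := by
    have := e.left_inv hes
    rwa [hep] at this
  have htgt : y₀ ∈ e.target := by
    have := e.map_source hes
    rwa [hep] at this
  have hsc : Tendsto e.symm (𝓝 y₀) (𝓝 y₀) := by
    have := (hec.differentiableAt (by simp)).continuousAt.tendsto
    rwa [hsymm] at this
  have hgood := (e.open_target.eventually_mem htgt).and <|
    (hec.analyticAt.eventually_analyticAt).and <|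
    hsc.eventually (hV.and hρ.eventually_analyticAt)
  obtain ⟨ε, hε, hgood⟩ := Metric.eventually_nhds_iff_ball.1 hgood
  have hV0 : ∀ u ∈ V, fderiv ℝ ρ y₀ u = 0 := hV.self_of_nhds h0
  -- On the hyperplane, dρ annihilates `V` both at `y₀` and at the zero `e.symm Y`. The correction
  -- term in the derivative of `e` therefore vanishes on `V`, and both `e` and its inverse have
  -- identity derivative there.
  have hderiv : ∀ Y ∈ Metric.ball y₀ ε, fderiv ℝ ρ y₀ (Y - y₀) = 0 → ∀ u ∈ V,
      fderiv ℝ e.symm Y u = u := by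
    intro Y hY hY0 u hu
    obtain ⟨h1, h2, h3, h4⟩ := hgood Y hY
    have hρY : ρ (e.symm Y) = 0 := by rw [← her, e.right_inv h1, hY0]
    have hed : HasFDerivAt e (ContinuousLinearMap.id ℝ G +
        (fderiv ℝ ρ (e.symm Y) - fderiv ℝ ρ y₀).smulRight v) (e.symm Y) := by
      have h5 : HasFDerivAt (fun x => x + (ρ x - fderiv ℝ ρ y₀ (x - y₀)) • v)
          (ContinuousLinearMap.id ℝ G +
            (fderiv ℝ ρ (e.symm Y) - fderiv ℝ ρ y₀).smulRight v) (e.symm Y) := by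
        refine (hasFDerivAt_id _).add (HasFDerivAt.smul_const ?_ v)
        refine h4.differentiableAt.hasFDerivAt.sub ?_
        exact (fderiv ℝ ρ y₀).hasFDerivAt.comp (e.symm Y) ((hasFDerivAt_id _).sub_const y₀)
      exact h5.congr_of_eventuallyEq (.of_forall he)
    have hcomp : HasFDerivAt (fun x => e.symm (e x)) ((fderiv ℝ e.symm Y).comp
        (ContinuousLinearMap.id ℝ G +
          (fderiv ℝ ρ (e.symm Y) - fderiv ℝ ρ y₀).smulRight v)) (e.symm Y) := by
      refine HasFDerivAt.comp (e.symm Y) ?_ hed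
      rw [e.right_inv h1]
      exact h2.differentiableAt.hasFDerivAt
    have hid : HasFDerivAt (fun x => e.symm (e x)) (ContinuousLinearMap.id ℝ G) (e.symm Y) := by
      refine (hasFDerivAt_id _).congr_of_eventuallyEq ?_
      filter_upwards [e.open_source.mem_nhds (e.map_target h1)] with x hx using e.left_inv hx
    have h6 := congrArg (fun A => A u) (hcomp.unique hid)
    simpa [h3 hρY u hu, hV0 u hu] using h6
  have htrans : ∀ Y ∈ Metric.ball y₀ ε, fderiv ℝ ρ y₀ (Y - y₀) = 0 → ∀ u ∈ V,
      Y + u ∈ Metric.ball y₀ ε → e.symm (Y + u) = e.symm Y + u := by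
    intro Y hY hY0 u hu hYu
    let g : ℝ → G := fun t => e.symm (Y + t • u) - t • u
    have hseg : ∀ t ∈ Icc (0 : ℝ) 1, Y + t • u ∈ Metric.ball y₀ ε := by
      intro t ht
      have := (convex_ball y₀ ε).add_smul_sub_mem hY hYu ht
      simpa using this
    have hgd : ∀ t ∈ Icc (0 : ℝ) 1, HasDerivAt g 0 t := by
      intro t ht
      have h1 := hseg t ht
      have h2 : HasDerivAt (fun t : ℝ => Y + t • u) u t := by
        simpa using ((hasDerivAt_id t).smul_const u).const_add Y
      have h3 := (hgood _ h1).2.1.differentiableAt.hasFDerivAt.comp_hasDerivAt t h2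
      rw [hderiv _ h1 (by
        rw [add_sub_right_comm, map_add, map_smul, hY0, hV0 u hu]; simp) u hu] at h3
      have h4 : HasDerivAt (fun t : ℝ => t • u) u t := by
        simpa using (hasDerivAt_id t).smul_const u
      have h5 := h3.sub h4
      rw [sub_self] at h5
      exact h5
    have hc := constant_of_has_deriv_right_zero
      (fun t ht => (hgd t ht).continuousAt.continuousWithinAt)
      (fun t ht => (hgd t ⟨ht.1, ht.2.le⟩).hasDerivWithinAt) 1 (right_mem_Icc.2 zero_le_one)
    simp only [g, one_smul, zero_smul, add_zero, sub_zero] at hc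
    exact sub_eq_iff_eq_add.1 hc
  have hnear : ∀ᶠ y in 𝓝 y₀, y ∈ e.source ∧ e y ∈ Metric.ball y₀ (ε / 2) := by
    have := (e.continuousAt hes).tendsto
    rw [hep] at this
    exact (e.open_source.eventually_mem hes).and
      (this.eventually (Metric.ball_mem_nhds _ (by positivity)))
  obtain ⟨η, hη, hnear⟩ := Metric.eventually_nhds_iff_ball.1 hnear
  -- Two points within ε/4 of `y₀` differ by less than ε/2, and `e y` is within ε/2, so `e y + u`
  -- remains in the ε-ball.
  refine ⟨min η (ε / 4), by positivity, fun y hy u hu hyu hρy => ?_⟩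
  obtain ⟨hys, hey⟩ := hnear y (Metric.ball_subset_ball (min_le_left _ _) hy)
  have hY0 : fderiv ℝ ρ y₀ (e y - y₀) = 0 := by rw [her, hρy]
  have hun : ‖u‖ < ε / 2 := by
    have h1 := Metric.ball_subset_ball (min_le_right _ _) hy
    have h2 := Metric.ball_subset_ball (min_le_right _ _) hyu
    rw [Metric.mem_ball, dist_eq_norm] at h1 h2
    have h3 : u = (y + u - y₀) - (y - y₀) := by abel
    rw [h3]
    linarith [norm_sub_le (y + u - y₀) (y - y₀)]
  have hYu : e y + u ∈ Metric.ball y₀ ε := by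
    rw [Metric.mem_ball, dist_eq_norm] at hey ⊢
    have : e y + u - y₀ = (e y - y₀) + u := by abel
    rw [this]
    linarith [norm_add_le (e y - y₀) u]
  have hYball : e y ∈ Metric.ball y₀ ε := Metric.ball_subset_ball (by linarith) hey
  have h1 := htrans _ hYball hY0 u hu hYu
  rw [e.left_inv hys] at h1
  rw [← h1, ← her, e.right_inv (hgood _ hYu).1, add_sub_right_comm, map_add, hY0, hV0 u hu, add_zero]

/-- In the coordinates φ the vertical directions are the multiples of `K`, all tangent to `M`. Hence
the transported defining function has a zero set invariant under small vertical translations. -/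
theorem isLocallyBiholomorphicToProduct_of_freeman {M : Set C3}
    (hM : IsRealAnalyticHypersurface M) (hLevi : ∀ q ∈ M, HasLeviRank M q 1)
    (hF : ∀ q ∈ M, FreemanFormVanishesAt M q) : IsLocallyBiholomorphicToProduct M := by
  intro p hp
  obtain ⟨r, R, h⟩ := hM.exists_isDefining hp
  obtain ⟨φ, T, K, hφ, hT, hK⟩ := h.exists_straightening_coordinates hp hLevi hF
  have hn : (⊤ : WithTop ℕ∞) ≠ 0 := by simp
  let e := (hφ.contDiffAt (n := ⊤)).toOpenPartialHomeomorph φ hT hn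
  have hps : p ∈ e.source := hφ.contDiffAt.mem_toOpenPartialHomeomorph_source hT hn
  have hpt : φ p ∈ e.target := e.map_source hps
  have hsymm : e.symm (φ p) = p := e.left_inv hps
  have hsa : AnalyticAt ℂ e.symm (φ p) := (hφ.contDiffAt.to_localInverse hT hn).analyticAt
  have hst : Tendsto e.symm (𝓝 (φ p)) (𝓝 p) := by
    have := hsa.continuousAt.tendsto
    rwa [hsymm] at this
  let ρ : (Fin 2 → ℂ) × ℂ → ℝ := fun y => r (e.symm y)
  have hρ : AnalyticAt ℝ ρ (φ p) :=
    AnalyticAt.comp_of_eq h.analyticAt_real (hsa.restrictScalars (𝕜 := ℝ)) hsymm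
  have hρ0 : ρ (φ p) = 0 := by
    show r (e.symm (φ p)) = 0
    rw [hsymm, h.apply_eq_zero hp]
  have hρd : ∀ y, AnalyticAt ℂ e.symm y → IsDefining M r R (e.symm y) → ∀ u,
      fderiv ℝ ρ y u = fderiv ℝ r (e.symm y) (fderiv ℂ e.symm y u) := by
    intro y hy hd u
    have h1 : HasFDerivAt ρ _ y := hd.analyticAt_real.differentiableAt.hasFDerivAt.comp y
      (hy.differentiableAt.hasFDerivAt.restrictScalars ℝ)
    rw [h1.fderiv]
    rfl
  have hinv : ∀ y ∈ e.target, AnalyticAt ℂ e.symm y → AnalyticAt ℂ φ (e.symm y) → ∀ u,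
      fderiv ℂ e.symm y (fderiv ℂ φ (e.symm y) u) = u := by
    intro y hy h1 h2 u
    have h3 : HasFDerivAt (fun x => e.symm (e x))
        ((fderiv ℂ e.symm y).comp (fderiv ℂ φ (e.symm y))) (e.symm y) := by
      refine HasFDerivAt.comp (e.symm y) ?_ h2.differentiableAt.hasFDerivAt
      rw [e.right_inv hy]
      exact h1.differentiableAt.hasFDerivAt
    have h4 : HasFDerivAt (fun x => e.symm (e x)) (ContinuousLinearMap.id ℂ C3) (e.symm y) := by
      refine (hasFDerivAt_id _).congr_of_eventuallyEq ?_
      filter_upwards [e.open_source.mem_nhds (e.map_target hy)] with x hx using e.left_inv hx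
    exact congrArg (fun A => A u) (h3.unique h4)
  have hρ' : fderiv ℝ ρ (φ p) ≠ 0 := by
    intro h0
    obtain ⟨v, hv⟩ := h.exists_fderiv_eq_one
    have h1 := hρd (φ p) hsa (by rwa [hsymm]) (fderiv ℂ φ p v)
    have h2 := hinv (φ p) hpt hsa (by rwa [hsymm]) v
    rw [hsymm] at h1 h2
    rw [h2, h0, hv] at h1
    exact zero_ne_one h1
  rw [eventually_nhdsWithin_iff] at hK
  have hgood := (e.open_target.eventually_mem hpt).and <| hsa.eventually_analyticAt.and <|
    (hst.eventually <| hφ.eventually_analyticAt.and <| h.eventually.and hK).and <|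
    hρ.eventually_analyticAt.and <| hρ.fderiv.continuousAt.eventually_ne hρ'
  have hvert : ∀ y, y ∈ e.target → AnalyticAt ℂ e.symm y → AnalyticAt ℂ φ (e.symm y) →
      IsDefining M r R (e.symm y) → (e.symm y ∈ M → fderiv ℂ φ (e.symm y) (K (e.symm y)) = (0, 1) ∧
        fderiv ℂ R (realVec (e.symm y)) (K (e.symm y), 0) = 0) → ρ y = 0 →
      ∀ c : ℂ, fderiv ℝ ρ y ((0 : Fin 2 → ℂ), c) = 0 := by
    intro y hy h1 h2 h3 h4 h5 c
    obtain ⟨e1, e2⟩ := h4 (h3.mem_iff.self_of_nhds.2 h5)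
    have e3 : ((0 : Fin 2 → ℂ), c) = fderiv ℂ φ (e.symm y) (c • K (e.symm y)) := by
      rw [map_smul, e1]
      simp
    rw [e3, hρd y h1 h3, hinv y hy h1 h2]
    have e4 : fderiv ℂ R (realVec (e.symm y)) (c • K (e.symm y), 0) = 0 := by
      have : ((c • K (e.symm y), 0) : CVec) = c • (K (e.symm y), 0) := by simp
      rw [this, map_smul, e2, smul_zero]
    exact ((h3.fderiv_inl_eq_zero_iff _).1 e4).1
  let V : Submodule ℝ ((Fin 2 → ℂ) × ℂ) := LinearMap.ker (LinearMap.fst ℝ (Fin 2 → ℂ) ℂ)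
  have hVmem : ∀ u, u ∈ V ↔ u.1 = 0 := fun u => Iff.rfl
  obtain ⟨ε₁, hε₁, hinvar⟩ := exists_ball_zero_invariant hρ hρ' hρ0 V (by
    filter_upwards [hgood] with y hy h0 u hu
    obtain ⟨h1, h2, ⟨h3, h4, h5⟩, -, -⟩ := hy
    have := hvert y h1 h2 h3 h4 h5 h0 u.2
    rwa [← (hVmem u).1 hu] at this)
  obtain ⟨ε₂, hε₂, hgood⟩ := Metric.eventually_nhds_iff_ball.1 hgood
  obtain ⟨ε, hε, hεε⟩ : ∃ ε > 0, ε ≤ ε₁ ∧ ε ≤ ε₂ :=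
    ⟨min ε₁ ε₂, lt_min hε₁ hε₂, min_le_left _ _, min_le_right _ _⟩
  -- In the sup norm `B` is a product of balls: each vertical line meeting `B` reaches the height
  -- `(φ p).2` inside `B`, and `hinvar` transfers zeros between its points.
  let B : Set ((Fin 2 → ℂ) × ℂ) := Metric.ball (φ p) ε
  have hB : IsOpen B := Metric.isOpen_ball
  have hBprod : ∀ y, y ∈ B ↔ y.1 ∈ Metric.ball (φ p).1 ε ∧ y.2 ∈ Metric.ball (φ p).2 ε := by
    intro y
    show y ∈ Metric.ball ((φ p).1, (φ p).2) ε ↔ _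
    rw [← ball_prod_same]
    rfl
  have hB₂ : ∀ y ∈ B, y ∈ Metric.ball (φ p) ε₂ := fun y hy => Metric.ball_subset_ball hεε.2 hy
  have hshift : ∀ x, ∀ c d : ℂ, (x, c) ∈ B → (x, d) ∈ B → ρ (x, c) = 0 → ρ (x, d) = 0 := by
    intro x c d hc hd h0
    have e1 : (x, d) = (x, c) + ((0 : Fin 2 → ℂ), d - c) := by simp
    rw [e1] at hd ⊢
    exact hinvar _ (Metric.ball_subset_ball hεε.1 hc) _ rfl (Metric.ball_subset_ball hεε.1 hd) h0
  let M' : Set (Fin 2 → ℂ) := {x | x ∈ Metric.ball (φ p).1 ε ∧ ρ (x, (φ p).2) = 0}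
  have hbase : ∀ x ∈ Metric.ball (φ p).1 ε, (x, (φ p).2) ∈ B := fun x hx =>
    (hBprod _).2 ⟨hx, Metric.mem_ball_self hε⟩
  refine ⟨M', ?_, (e.symm.restr B).symm, ?_, ?_, ?_, ?_⟩
  · rintro x ⟨hx, hx0⟩
    obtain ⟨h1, h2, ⟨h3, h4, h5⟩, h6, h7⟩ := hgood _ (hB₂ _ (hbase x hx))
    have hd : HasFDerivAt (fun z => ρ (z, (φ p).2))
        ((fderiv ℝ ρ (x, (φ p).2)).comp (ContinuousLinearMap.inl ℝ (Fin 2 → ℂ) ℂ)) x := by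
      have hin : HasFDerivAt (𝕜 := ℝ) (fun z : Fin 2 → ℂ => (z, (φ p).2))
        (ContinuousLinearMap.inl ℝ (Fin 2 → ℂ) ℂ) x := hasFDerivAt_prodMk_left x (φ p).2
      have hρx : HasFDerivAt ρ (fderiv ℝ ρ (x, (φ p).2)) (x, (φ p).2) :=
        h6.differentiableAt.hasFDerivAt
      exact HasFDerivAt.comp (g := ρ) (f := fun z : Fin 2 → ℂ => (z, (φ p).2)) x hρx hin
    refine ⟨fun z => ρ (z, (φ p).2), ?_, ?_, ?_⟩
    · exact AnalyticAt.comp_of_eq (g := ρ) (f := fun z : Fin 2 → ℂ => (z, (φ p).2)) h6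
        (analyticAt_id.prod analyticAt_const) rfl
    -- At zeros of `ρ` its differential annihilates vertical vectors, so being nonzero it is nonzero
    -- on horizontal ones.
    · rw [hd.fderiv]
      intro h0
      refine h7 (ContinuousLinearMap.ext fun u => ?_)
      have e1 : u = (u.1, 0) + ((0 : Fin 2 → ℂ), u.2) := by simp
      rw [e1, map_add, hvert _ h1 h2 h3 h4 h5 hx0, add_zero]
      exact congrArg (fun A => A u.1) h0
    · filter_upwards [Metric.isOpen_ball.mem_nhds hx] with z hz
      exact ⟨fun hz' => hz'.2, fun hz' => ⟨hz, hz'⟩⟩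
  · simp only [OpenPartialHomeomorph.symm_source, OpenPartialHomeomorph.restr_target, hB.interior_eq]
    refine ⟨hps, ?_⟩
    exact Metric.mem_ball_self hε
  · intro x hx
    simp only [OpenPartialHomeomorph.symm_source, OpenPartialHomeomorph.restr_target,
      hB.interior_eq] at hx
    have h1 : e x ∈ B := hx.2
    have h2 : e.symm (e x) = x := e.left_inv hx.1
    have h3 := (hgood _ (hB₂ _ h1)).2.2.1.1
    rw [h2] at h3
    exact h3.differentiableAt.differentiableWithinAt
  · intro y hy
    simp only [OpenPartialHomeomorph.symm_target, OpenPartialHomeomorph.restr_source,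
      hB.interior_eq] at hy
    exact (hgood _ (hB₂ _ hy.2)).2.1.differentiableAt.differentiableWithinAt
  · ext y
    simp only [OpenPartialHomeomorph.symm_source, OpenPartialHomeomorph.restr_target,
      OpenPartialHomeomorph.symm_target, OpenPartialHomeomorph.restr_source, hB.interior_eq]
    constructor
    · rintro ⟨x, ⟨hxM, hxs, hxB⟩, rfl⟩
      have hxB' : e x ∈ B := hxB
      have h2 : e.symm (e x) = x := e.left_inv hxs
      have hd := (hgood _ (hB₂ _ hxB')).2.2.1.2.1
      rw [h2] at hd
      have h0 : ρ (e x) = 0 := by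
        show r (e.symm (e x)) = 0
        rw [h2, hd.apply_eq_zero hxM]
      have hx1 := ((hBprod _).1 hxB').1
      exact ⟨⟨⟨hx1, hshift _ _ _ hxB' (hbase _ hx1) h0⟩, mem_univ _⟩, e.map_source hxs, hxB'⟩
    · rintro ⟨⟨⟨hy1, hy0⟩, -⟩, hyt, hyB⟩
      have hyt' : y ∈ e.target := hyt
      have h0 : ρ y = 0 := hshift y.1 _ y.2 (hbase _ hy1) hyB hy0
      have hd := (hgood _ (hB₂ _ hyB)).2.2.1.2.1
      refine ⟨e.symm y, ⟨hd.mem_iff.self_of_nhds.2 h0, e.map_target hyt', ?_⟩, e.right_inv hyt'⟩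
      show e (e.symm y) ∈ B
      rw [e.right_inv hyt']
      exact hyB

end CRGeom

end

theorem mainTheorem2 (M : Set CRGeom.C3) (hM : CRGeom.IsRealAnalyticHypersurface M)
    (hLevi : ∀ p ∈ M, CRGeom.HasLeviRank M p 1) :
    (∀ p ∈ M, CRGeom.FreemanFormVanishesAt M p) ↔ CRGeom.IsLocallyBiholomorphicToProduct M :=
  ⟨CRGeom.isLocallyBiholomorphicToProduct_of_freeman hM hLevi,
    fun h _ hp => CRGeom.freemanFormVanishesAt_of_product hM hLevi h hp⟩
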